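/- Let $X$ be a finite set of variables, let $U=\mathbb{Z}[X]$ be the (commutative) polynomial ring, let $A$ be a free $U$-module, and let $p$ be a prime. Let $L(A)$ be the free Lie ring on the underlying abelian group of $A$. For $c\ge 1$ let $L^c(A)$ be its homogeneous component of degree $c$, that is, the additive span of all left-normed Lie products $[a_1,a_2,\dots,a_c]$ with $a_i\in A$, and let $L(A)''$ be the second derived ideal of $L(A)$. Regard $L(A)$ as a $U$-module under the derivation action: each $x\in X$ acts as the derivation of $L(A)$ that extends the map $a\mapsto ax$ on $A$, so that $$[a_1,\dots,a_c]\,x=\sum_{i=1}^{c}[a_1,\dots,a_ix,\dots,a_c].$$ Then $L^p(A)$, $L(A)''$ and $$B^p(A)=L^p(A)\cap L(A)''$$ are $U$-submodules of $L(A)$. Regard $\mathbb{Z}$ as the trivial $U$-module, on which every $x\in X$ acts as $0$. Then $B^p(A)\otimes_U\mathbb{Z}$ is a free abelian group. -/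

import Mathlib

noncomputable section

universe u v w

/-! ### The free Lie algebra on a module -/

/-- The Lie ideal of the free Lie algebra on the underlying set of `A` that makes the
map `a ↦ of a` linear. -/
def freeLieLinearityIdeal (R : Type u) (A : Type v) [CommRing R] [AddCommGroup A] [Module R A] :
    LieIdeal R (FreeLieAlgebra R A) :=
  LieSubmodule.lieSpan R (FreeLieAlgebra R A)
    ({z | ∃ a b : A, z = FreeLieAlgebra.of R (a + b) -
        (FreeLieAlgebra.of R a + FreeLieAlgebra.of R b)} ∪
      {z | ∃ (r : R) (a : A), z = FreeLieAlgebra.of R (r • a) - r • FreeLieAlgebra.of R a})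

/-- `FreeLie R A` is the free Lie algebra `L(A)` over `R` on the `R`-module `A`: every `R`-linear
map from `A` to a Lie algebra over `R` extends uniquely to a homomorphism of Lie algebras
(see `FreeLie.lift`). For `R = ℤ` it is the free Lie ring on the abelian group `A`. -/
def FreeLie (R : Type u) (A : Type v) [CommRing R] [AddCommGroup A] [Module R A] : Type (max u v) :=
  FreeLieAlgebra R A ⧸ freeLieLinearityIdeal R A

namespace FreeLie

section Basic

variable (R : Type u) (A : Type v) [CommRing R] [AddCommGroup A] [Module R A]

instance : LieRing (FreeLie R A) :=
  inferInstanceAs (LieRing (FreeLieAlgebra R A ⧸ freeLieLinearityIdeal R A))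

instance : LieAlgebra R (FreeLie R A) :=
  inferInstanceAs (LieAlgebra R (FreeLieAlgebra R A ⧸ freeLieLinearityIdeal R A))

/-- The quotient map. -/
def mkHom : FreeLieAlgebra R A →ₗ⁅R⁆ FreeLie R A where
  toFun x := (LieSubmodule.Quotient.mk x : FreeLieAlgebra R A ⧸ freeLieLinearityIdeal R A)
  map_add' _ _ := rfl
  map_smul' _ _ := rfl
  map_lie' := rfl

theorem mkHom_surjective : Function.Surjective (mkHom R A) :=
  Quot.mk_surjective

theorem mkHom_eq_zero {x : FreeLieAlgebra R A} (hx : x ∈ freeLieLinearityIdeal R A) :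
    mkHom R A x = 0 :=
  LieSubmodule.Quotient.mk_eq_zero'.mpr hx

/-- The canonical linear map from `A` to the free Lie algebra on `A`. -/
def ι : A →ₗ[R] FreeLie R A where
  toFun a := mkHom R A (FreeLieAlgebra.of R a)
  map_add' a b := by
    have h := mkHom_eq_zero R A (LieSubmodule.subset_lieSpan (R := R) (L := FreeLieAlgebra R A)
      (Or.inl ⟨a, b, rfl⟩ : FreeLieAlgebra.of R (a + b) -
        (FreeLieAlgebra.of R a + FreeLieAlgebra.of R b) ∈ _ ∪ _))
    rw [map_sub, map_add, sub_eq_zero] at h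
    exact h
  map_smul' r a := by
    have h := mkHom_eq_zero R A (LieSubmodule.subset_lieSpan (R := R) (L := FreeLieAlgebra R A)
      (Or.inr ⟨r, a, rfl⟩ : FreeLieAlgebra.of R (r • a) - r • FreeLieAlgebra.of R a ∈ _ ∪ _))
    rw [map_sub, map_smul, sub_eq_zero] at h
    exact h

variable {R A} {L : Type w} [LieRing L] [LieAlgebra R L]

/-- Homomorphisms out of `FreeLie R A` are determined by their values on `A`. -/
theorem hom_ext {F G : FreeLie R A →ₗ⁅R⁆ L} (h : ∀ a, F (ι R A a) = G (ι R A a)) : F = G := by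
  have h' : F.comp (mkHom R A) = G.comp (mkHom R A) := FreeLieAlgebra.hom_ext h
  ext x
  obtain ⟨y, rfl⟩ := mkHom_surjective R A x
  exact LieHom.congr_fun h' y

theorem le_ker_lift (f : A →ₗ[R] L) :
    freeLieLinearityIdeal R A ≤ (FreeLieAlgebra.lift R (f : A → L)).ker := by
  refine LieSubmodule.lieSpan_le.mpr ?_
  rintro z (⟨a, b, rfl⟩ | ⟨r, a, rfl⟩) <;> simp [LieHom.mem_ker]

/-- The universal property: the extension of a linear map to the free Lie algebra. -/
def lift (f : A →ₗ[R] L) : FreeLie R A →ₗ⁅R⁆ L where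
  toLinearMap := (freeLieLinearityIdeal R A).toSubmodule.liftQ
    ((FreeLieAlgebra.lift R (f : A → L) : FreeLieAlgebra R A →ₗ⁅R⁆ L) :
      FreeLieAlgebra R A →ₗ[R] L) (fun x hx => le_ker_lift f hx)
  map_lie' := by
    intro x y
    obtain ⟨x, rfl⟩ := mkHom_surjective R A x
    obtain ⟨y, rfl⟩ := mkHom_surjective R A y
    rw [← LieHom.map_lie]
    exact LieHom.map_lie (FreeLieAlgebra.lift R (f : A → L)) x y

@[simp]
theorem lift_ι (f : A →ₗ[R] L) (a : A) : lift f (ι R A a) = f a :=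
  FreeLieAlgebra.lift_of_apply (R := R) (f : A → L) a

variable (R A)

/-- The free Lie algebra on `A` is generated by `A`. -/
theorem lieSpan_range_ι : LieSubalgebra.lieSpan R (FreeLie R A) (Set.range (ι R A)) = ⊤ := by
  set S := LieSubalgebra.lieSpan R (FreeLie R A) (Set.range (ι R A)) with hS
  let f : A →ₗ[R] S := (ι R A).codRestrict S.toSubmodule
    (fun a => LieSubalgebra.subset_lieSpan ⟨a, rfl⟩)
  have h : S.incl.comp (lift f) = LieHom.id := hom_ext fun a => by
    simp only [LieHom.comp_apply, lift_ι, LieHom.id_apply]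
    rfl
  rw [eq_top_iff]
  intro x _
  have hx : ((lift f x : S) : FreeLie R A) = x := LieHom.congr_fun h x
  rw [← hx]
  exact (lift f x).2

end Basic

/-! ### Extending endomorphisms to derivations -/

/-- The Lie algebra `L[ε]/(ε²)`, an auxiliary tool to construct derivations. -/
def Dual (L : Type w) : Type w := L × L

section Dual

variable (R : Type u) [CommRing R] (L : Type w) [LieRing L] [LieAlgebra R L]

instance : AddCommGroup (Dual L) := inferInstanceAs (AddCommGroup (L × L))

instance : Module R (Dual L) := inferInstanceAs (Module R (L × L))

instance : LieRing (Dual L) where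
  bracket x y := ((⁅x.1, y.1⁆, ⁅x.1, y.2⁆ + ⁅x.2, y.1⁆) : L × L)
  add_lie x y z := Prod.ext (add_lie x.1 y.1 z.1) (by
    change ⁅x.1 + y.1, z.2⁆ + ⁅x.2 + y.2, z.1⁆ =
      (⁅x.1, z.2⁆ + ⁅x.2, z.1⁆) + (⁅y.1, z.2⁆ + ⁅y.2, z.1⁆)
    rw [add_lie, add_lie]; abel)
  lie_add x y z := Prod.ext (lie_add x.1 y.1 z.1) (by
    change ⁅x.1, y.2 + z.2⁆ + ⁅x.2, y.1 + z.1⁆ =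
      (⁅x.1, y.2⁆ + ⁅x.2, y.1⁆) + (⁅x.1, z.2⁆ + ⁅x.2, z.1⁆)
    rw [lie_add, lie_add]; abel)
  lie_self x := Prod.ext (lie_self x.1) (by
    change ⁅x.1, x.2⁆ + ⁅x.2, x.1⁆ = 0
    rw [← lie_skew x.1 x.2]; abel)
  leibniz_lie x y z := Prod.ext (leibniz_lie x.1 y.1 z.1) (by
    change ⁅x.1, ⁅y.1, z.2⁆ + ⁅y.2, z.1⁆⁆ + ⁅x.2, ⁅y.1, z.1⁆⁆ =
      (⁅⁅x.1, y.1⁆, z.2⁆ + ⁅⁅x.1, y.2⁆ + ⁅x.2, y.1⁆, z.1⁆) +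
      (⁅y.1, ⁅x.1, z.2⁆ + ⁅x.2, z.1⁆⁆ + ⁅y.2, ⁅x.1, z.1⁆⁆)
    rw [lie_add, lie_add, add_lie, leibniz_lie x.1 y.1 z.2, leibniz_lie x.1 y.2 z.1,
      leibniz_lie x.2 y.1 z.1]
    abel)

instance : LieAlgebra R (Dual L) where
  lie_smul r x y := Prod.ext (lie_smul r x.1 y.1) (by
    change ⁅x.1, r • y.2⁆ + ⁅x.2, r • y.1⁆ = r • (⁅x.1, y.2⁆ + ⁅x.2, y.1⁆)
    rw [lie_smul, lie_smul, smul_add])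

/-- The projection `L[ε]/(ε²) → L`, `ε ↦ 0`. -/
def Dual.fstHom : Dual L →ₗ⁅R⁆ L where
  toFun x := x.1
  map_add' _ _ := rfl
  map_smul' _ _ := rfl
  map_lie' := rfl

end Dual

section Derivation

variable {R : Type u} {A : Type v} [CommRing R] [AddCommGroup A] [Module R A]

/-- The homomorphism `L(A) → L(A)[ε]/(ε²)` with `a ↦ a + ε f(a)` for `a ∈ A`. -/
def dualHom (f : A →ₗ[R] A) : FreeLie R A →ₗ⁅R⁆ Dual (FreeLie R A) :=
  lift
    { toFun := fun a => ((ι R A a, ι R A (f a)) : FreeLie R A × FreeLie R A)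
      map_add' := fun a b => by rw [map_add, map_add, map_add]; rfl
      map_smul' := fun r a => by rw [map_smul, map_smul, map_smul]; rfl }

theorem dualHom_fst (f : A →ₗ[R] A) (x : FreeLie R A) : (dualHom f x).1 = x := by
  have h : (Dual.fstHom R (FreeLie R A)).comp (dualHom f) = LieHom.id := hom_ext fun a => by
    simp only [LieHom.comp_apply, dualHom, lift_ι, LieHom.id_apply]
    rfl
  exact LieHom.congr_fun h x

/-- The unique derivation of `L(A)` that extends the endomorphism `f` of `A`. -/
def derivation (f : A →ₗ[R] A) : LieDerivation R (FreeLie R A) (FreeLie R A) where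
  toFun x := (dualHom f x).2
  map_add' x y := by rw [map_add]; rfl
  map_smul' r x := by rw [map_smul]; rfl
  leibniz' x y := by
    change (dualHom f ⁅x, y⁆).2 = ⁅x, (dualHom f y).2⁆ - ⁅y, (dualHom f x).2⁆
    rw [LieHom.map_lie]
    change ⁅(dualHom f x).1, (dualHom f y).2⁆ + ⁅(dualHom f x).2, (dualHom f y).1⁆ = _
    rw [dualHom_fst, dualHom_fst, sub_eq_add_neg, lie_skew]

@[simp]
theorem derivation_ι (f : A →ₗ[R] A) (a : A) : derivation f (ι R A a) = ι R A (f a) := by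
  change (dualHom f (ι R A a)).2 = _
  rw [dualHom, lift_ι]
  rfl

theorem derivation_comm {f g : A →ₗ[R] A} (h : ∀ a, f (g a) = g (f a)) (x : FreeLie R A) :
    derivation f (derivation g x) = derivation g (derivation f x) := by
  have h0 : ⁅derivation f, derivation g⁆ = 0 :=
    LieDerivation.ext_of_lieSpan_eq_top _ (lieSpan_range_ι R A) (by
      rintro _ ⟨a, rfl⟩
      simp [h])
  have h1 := LieDerivation.congr_fun h0 x
  rwa [LieDerivation.commutator_apply, LieDerivation.zero_apply, sub_eq_zero] at h1

end Derivation

/-! ### Homogeneous components -/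

section Components

variable (R : Type u) {A : Type v} [CommRing R] [AddCommGroup A] [Module R A]

/-- The left-normed Lie product `[a₁, a₂, …, a_c]`, where `l` is the list `a₂, …, a_c`. -/
def leftNormed (a : A) (l : List A) : FreeLie R A :=
  l.foldl (fun x b => ⁅x, ι R A b⁆) (ι R A a)

variable (A)

/-- The homogeneous component `L^c(A)` of degree `c` (for `c ≥ 1`): the span of all left-normed
Lie products `[a₁, …, a_c]` with all `aᵢ` in `A`. -/
def component (c : ℕ) : Submodule R (FreeLie R A) :=
  Submodule.span R {x | ∃ (a : A) (l : List A), l.length + 1 = c ∧ x = leftNormed R a l}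

variable {A}

theorem leftNormed_concat (a b : A) (l : List A) :
    leftNormed R a (l ++ [b]) = ⁅leftNormed R a l, ι R A b⁆ := by
  simp [leftNormed, List.foldl_append]

theorem lie_ι_mem_component {c : ℕ} {x : FreeLie R A} (hx : x ∈ component R A c) (b : A) :
    ⁅x, ι R A b⁆ ∈ component R A (c + 1) := by
  induction hx using Submodule.span_induction with
  | mem x hx =>
    obtain ⟨a, l, hl, rfl⟩ := hx
    exact Submodule.subset_span ⟨a, l ++ [b], by simp [hl], (leftNormed_concat R a b l).symm⟩
  | zero => rw [zero_lie]; exact zero_mem _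
  | add x y _ _ hx hy => rw [add_lie]; exact add_mem hx hy
  | smul r x _ hx => rw [smul_lie]; exact Submodule.smul_mem _ _ hx

theorem leftNormed_mem_component (a : A) (l : List A) :
    leftNormed R a l ∈ component R A (l.length + 1) :=
  Submodule.subset_span ⟨a, l, rfl, rfl⟩

theorem derivation_mem_component (f : A →ₗ[R] A) {c : ℕ} {x : FreeLie R A}
    (hx : x ∈ component R A c) : derivation f x ∈ component R A c := by
  induction hx using Submodule.span_induction with
  | mem x hx =>
    obtain ⟨a, l, rfl, rfl⟩ := hx
    induction l using List.reverseRecOn with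
    | nil =>
      have h : derivation f (leftNormed R a []) = leftNormed R (f a) [] := derivation_ι f a
      rw [h]
      exact leftNormed_mem_component R (f a) []
    | append_singleton l b ih =>
      rw [leftNormed_concat, LieDerivation.apply_lie_eq_add, derivation_ι, List.length_append]
      exact add_mem (lie_ι_mem_component R (leftNormed_mem_component R a l) (f b))
        (lie_ι_mem_component R ih b)
  | zero => rw [map_zero]; exact zero_mem _
  | add x y _ _ hx hy => rw [map_add]; exact add_mem hx hy
  | smul r x _ hx => rw [map_smul]; exact Submodule.smul_mem _ _ hx

theorem derivation_mem_derivedSeries (f : A →ₗ[R] A) (k : ℕ) :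
    ∀ {x : FreeLie R A}, x ∈ LieAlgebra.derivedSeries R (FreeLie R A) k →
      derivation f x ∈ LieAlgebra.derivedSeries R (FreeLie R A) k := by
  induction k with
  | zero => intro x _; exact LieSubmodule.mem_top _
  | succ k ih =>
    intro x hx
    rw [LieAlgebra.derivedSeries_def, LieAlgebra.derivedSeriesOfIdeal_succ,
      ← LieSubmodule.mem_toSubmodule, LieSubmodule.lieIdeal_oper_eq_linear_span'] at hx ⊢
    induction hx using Submodule.span_induction with
    | mem x hx =>
      obtain ⟨y, hy, z, hz, rfl⟩ := hx
      rw [LieDerivation.apply_lie_eq_add]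
      exact add_mem (Submodule.subset_span ⟨y, hy, _, ih hz, rfl⟩)
        (Submodule.subset_span ⟨_, ih hy, z, hz, rfl⟩)
    | zero => rw [map_zero]; exact zero_mem _
    | add x y _ _ hx hy => rw [map_add]; exact add_mem hx hy
    | smul r x _ hx => rw [map_smul]; exact Submodule.smul_mem _ _ hx

end Components

/-! ### The derivation action of a polynomial ring -/

section Action

variable (R : Type u) (A : Type v) (σ : Type w) [CommRing R] [AddCommGroup A] [Module R A]
  [Module (MvPolynomial σ R) A] [IsScalarTower R (MvPolynomial σ R) A]

/-- The action of a variable `x` on `L(A)`: the derivation that extends `a ↦ x • a` on `A`. -/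
def actX (i : σ) : Module.End R (FreeLie R A) :=
  (derivation (Algebra.lsmul R R A (MvPolynomial.X i : MvPolynomial σ R)) :
    LieDerivation R (FreeLie R A) (FreeLie R A)).toLinearMap

theorem actX_comm (i j : σ) : actX R A σ i * actX R A σ j = actX R A σ j * actX R A σ i := by
  ext x
  exact derivation_comm (fun a => by simp [smul_smul, mul_comm]) x

/-- The action of the polynomial ring by endomorphisms of `L(A)`: since the operators `actX i`
commute, there is a unique algebra homomorphism with `X i ↦ actX i`. -/
def act : MvPolynomial σ R →ₐ[R] Module.End R (FreeLie R A) :=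
  letI : CommRing (Algebra.adjoin R (Set.range (actX R A σ))) :=
    { (inferInstance : Ring (Algebra.adjoin R (Set.range (actX R A σ)))) with
      mul_comm := (Algebra.isMulCommutative_adjoin R (by
        rintro _ ⟨i, rfl⟩ _ ⟨j, rfl⟩
        exact actX_comm R A σ i j)).is_comm.comm }
  (Algebra.adjoin R (Set.range (actX R A σ))).val.comp
    (MvPolynomial.aeval fun i => ⟨actX R A σ i, Algebra.subset_adjoin ⟨i, rfl⟩⟩)

theorem act_X (i : σ) : act R A σ (MvPolynomial.X i) = actX R A σ i := by
  simp [act]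

/-- `L(A)` as a module over the polynomial ring under the derivation action. -/
instance : Module (MvPolynomial σ R) (FreeLie R A) :=
  Module.compHom (FreeLie R A) (act R A σ).toRingHom

variable {A σ}

theorem smul_def (u : MvPolynomial σ R) (x : FreeLie R A) : u • x = act R A σ u x := rfl

theorem C_smul (r : R) (x : FreeLie R A) : (MvPolynomial.C r : MvPolynomial σ R) • x = r • x := by
  rw [smul_def, ← MvPolynomial.algebraMap_eq, AlgHom.commutes]
  rfl

theorem X_smul_ι (i : σ) (a : A) :
    (MvPolynomial.X i : MvPolynomial σ R) • ι R A a =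
      ι R A ((MvPolynomial.X i : MvPolynomial σ R) • a) := by
  rw [smul_def, act_X]
  exact derivation_ι _ a

theorem X_smul_lie (i : σ) (x y : FreeLie R A) :
    (MvPolynomial.X i : MvPolynomial σ R) • ⁅x, y⁆ =
      ⁅x, (MvPolynomial.X i : MvPolynomial σ R) • y⁆ +
        ⁅(MvPolynomial.X i : MvPolynomial σ R) • x, y⁆ := by
  simp only [smul_def, act_X]
  exact LieDerivation.apply_lie_eq_add _ x y

/-- An `R`-submodule of `L(A)` that is stable under the variables is stable under the action. -/
theorem smul_mem_of_X_smul_mem (N : Submodule R (FreeLie R A))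
    (h : ∀ (i : σ), ∀ x ∈ N, (MvPolynomial.X i : MvPolynomial σ R) • x ∈ N)
    (u : MvPolynomial σ R) {x : FreeLie R A} (hx : x ∈ N) : u • x ∈ N := by
  induction u using MvPolynomial.induction_on generalizing x with
  | C r => rw [C_smul]; exact N.smul_mem r hx
  | add p q hp hq => rw [add_smul]; exact add_mem (hp hx) (hq hx)
  | mul_X p i hp => rw [mul_smul]; exact hp (h i x hx)

variable (A σ)

/-- The `c`-th Lie power `L^c(A)` as a module over the polynomial ring. -/
def liePower (c : ℕ) : Submodule (MvPolynomial σ R) (FreeLie R A) where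
  carrier := component R A c
  add_mem' := add_mem
  zero_mem' := zero_mem _
  smul_mem' u _ hx := smul_mem_of_X_smul_mem R (component R A c)
    (fun i x hx => by rw [smul_def, act_X]; exact derivation_mem_component R _ hx) u hx

/-- The second derived ideal `L(A)''` as a module over the polynomial ring. -/
def secondDerived : Submodule (MvPolynomial σ R) (FreeLie R A) where
  carrier := LieAlgebra.derivedSeries R (FreeLie R A) 2
  add_mem' := add_mem
  zero_mem' := zero_mem _
  smul_mem' u _ hx := smul_mem_of_X_smul_mem R
    (LieAlgebra.derivedSeries R (FreeLie R A) 2).toSubmodule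
    (fun i x hx => by rw [smul_def, act_X]; exact derivation_mem_derivedSeries R _ 2 hx) u hx

/-- `B^c(A) = L^c(A) ∩ L(A)''`, as a module over the polynomial ring. -/
def B (c : ℕ) : Submodule (MvPolynomial σ R) (FreeLie R A) :=
  liePower R A σ c ⊓ secondDerived R A σ

end Action

end FreeLie

/-- The ground ring `R` as a trivial module over the polynomial ring: every variable acts as `0`,
that is, a polynomial acts as multiplication by its constant coefficient. -/
def TrivialModule (R : Type u) (_σ : Type w) [CommRing R] : Type u := R

namespace TrivialModule

variable (R : Type u) (σ : Type w) [CommRing R]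

instance : AddCommGroup (TrivialModule R σ) := inferInstanceAs (AddCommGroup R)

instance : Module (MvPolynomial σ R) (TrivialModule R σ) :=
  Module.compHom R (MvPolynomial.constantCoeff : MvPolynomial σ R →+* R)

end TrivialModule

end

/-!
It suffices that `B^p(A)` is projective over `U = ℤ[X]`: then `B^p(A) ⊗ ℤ` is a subgroup of a free
abelian group (`TrivialModule.free_tensorProduct`). Call a subquotient of `L(A)` projective up to
an integer `N` if multiplication by `N` on it factors through a projective `U`-module
(`ProjectiveUpTo`). If `B^p(A)` is projective up to two coprime integers, an integral combination
of the two factorisations splits a free cover. The integers used here are `p ^ 2` and one that is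
prime to `p`.

Factorisations come from tensor products. Since `A` is projective over `U`, a tensor product
`A ⊗ W` over the ground ring with the diagonal action has the lifting property of a projective
module whenever `W` is free over the ground ring (`exists_equivariant_lift`, by the adjunction
between `A ⊗ W` and `Hom(W, -)`). So it is enough to map the subquotient equivariantly to such a
tensor product and back, with composite `N` (`ProjectiveUpTo.of_tensor`).

* For `L^p(A)`, the natural map to the tensor power and the Dynkin operator have composite `p`
  (`projectiveUpTo_liePower`).
* Let `L' = ⨁_{k ≥ 2} L^k(A)` be the derived algebra, so that `B^p(A)` is the component of degree
  `p` of `γ_2(L') = L''`. Let `Y = A ⊗ S(A)`, and let `a ∈ A` act on the tensor algebra `T(Y)` by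
  the left multiplication by `a ⊗ 1` plus the derivation that extends the multiplication by `a` on
  `Y`. This extends to a representation of `L(A)`; the orbit map `foxMap` of the unit is, on `L'`,
  compatible with commutators. Its linear part `L' / L'' → Y` and a map `contract : Y → L' / L''`
  have composite `k` in degree `k` (`contract_ιInv_foxMap`). Hence the metabelian factor
  `L^p(A) / B^p(A)` is projective up to `p`, and with `L^p(A)` also `B^p(A)` up to `p ^ 2`
  (`projectiveUpTo_B`).
* The factor `γ_c(L') / γ_{c+1}(L')` for `c ≥ 2` is treated in the same way with the component of
  degree `c` of `foxMap`, followed by a Dynkin operator that takes Lie products of values of a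
  lift `r : Y → L'` of `contract`. In degree `p` it only involves elements of `L'` of degree less
  than `p`, so that `r` can be rescaled degree by degree to have the uniform multiplier `(p - 1)!`
  in place of `k` (`degreeScaling`). The composite becomes `c (p - 1)! ^ c`
  (`dynkinRelation_succ`). The factor is zero unless `2 c ≤ p`, so this is prime to `p`, and
  climbing the finite series gives a multiplier of `B^p(A)` that is prime to `p`
  (`projectiveUpTo_B_coprime`).

The map `r` is equivariant only modulo `L''`, and `foxMap` is multiplicative only on `L'`; both
suffice because each factor is taken modulo the next term of the series.
-/


noncomputable section

/-! ### Submodules of free modules over a principal ideal domain -/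

/-- Submodules of free modules of arbitrary rank over a principal ideal domain are free. Along a
well-ordering of the basis, the leading coefficients of the elements with leading index `j` form
a principal ideal; one element for each nonzero ideal, with a generator as leading coefficient,
gives a basis. -/
theorem Submodule.free_of_le_finsupp {R : Type u} [CommRing R] [IsDomain R]
    [IsPrincipalIdealRing R] {J : Type v} (N : Submodule R (J →₀ R)) : Module.Free R N := by
  classical
  let _ : LinearOrder J := linearOrderOfSTO WellOrderingRel
  have : WellFoundedLT J := ⟨(IsWellOrder.toIsWellFounded (r := WellOrderingRel (α := J))).wf⟩
  let below (j : J) : Submodule R (J →₀ R) := N ⊓ Finsupp.supported R R (Set.Iic j)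
  let lead (j : J) : Ideal R := (below j).map (Finsupp.lapply j)
  have hgen (j : J) : ∃ e ∈ below j, lead j = Ideal.span {e j} := by
    obtain ⟨d, hd⟩ := (IsPrincipalIdealRing.principal (lead j)).principal
    have hmem : d ∈ lead j := by rw [hd]; exact Submodule.mem_span_singleton_self d
    obtain ⟨e, he, hed⟩ := hmem
    have hed' : e j = d := hed
    exact ⟨e, he, by rw [hd, hed', Ideal.submodule_span_eq]⟩
  choose e he hlead using hgen
  -- The `e j` with nonzero leading coefficient are in echelon form, hence independent.
  have hezero {j k : J} (h : j < k) : e j k = 0 := by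
    by_contra hne
    have := (Finsupp.mem_supported R (e j)).mp (he j).2 (Finsupp.mem_support_iff.mpr hne)
    exact absurd (Set.mem_Iic.mp this) (not_le.mpr h)
  let K := {j : J // e j j ≠ 0}
  let b : K → N := fun j => ⟨e j, (he j).1⟩
  have hli : LinearIndependent R b := by
    refine (injective_iff_map_eq_zero (Finsupp.linearCombination R b)).mpr fun l hl => ?_
    by_contra hne
    obtain ⟨m, hm, hmax⟩ := l.support.exists_max_image id (Finsupp.support_nonempty_iff.mpr hne)
    have h1 : (Finsupp.linearCombination R b l : J →₀ R) m.1 = l m * e m m := by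
      rw [Finsupp.linearCombination_apply, Finsupp.sum, Submodule.coe_sum, Finsupp.finsetSum_apply,
        Finset.sum_eq_single m]
      · rfl
      · intro k hk hkm
        have hlt : k.1 < m.1 := lt_of_le_of_ne (hmax k hk) (fun h => hkm (Subtype.ext h))
        change l k * e k m = 0
        rw [hezero hlt, mul_zero]
      · intro h
        exact absurd hm h
    rw [hl] at h1
    exact mul_ne_zero (Finsupp.mem_support_iff.mp hm) m.2 h1.symm
  -- Subtracting a multiple of `e j` from `f` cancels the coefficient at `j`: induction on `j`.
  have hspan : ∀ j : J, ∀ f ∈ below j,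
      f ∈ Submodule.span R (Set.range fun k : K => e k) := by
    intro j
    induction j using WellFoundedLT.induction with
    | ind j ih =>
    intro f hf
    have hfj : f j ∈ lead j := ⟨f, hf, rfl⟩
    rw [hlead, Ideal.mem_span_singleton'] at hfj
    obtain ⟨c, hc⟩ := hfj
    have hce : c • e j ∈ Submodule.span R (Set.range fun k : K => e k) := by
      by_cases h0 : e j j = 0
      · have hbot : ∀ k, ∀ g ∈ below j, g j = 0 → (∀ i ∈ g.support, i ≤ k) → k < j →
            g ∈ Submodule.span R (Set.range fun k : K => e k) := fun k g hg _ hk hkj =>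
          ih k hkj g ⟨hg.1, (Finsupp.mem_supported R g).mpr fun i hi => hk i hi⟩
        rcases eq_or_ne (e j) 0 with h | h
        · rw [h, smul_zero]; exact zero_mem _
        obtain ⟨m, hm, hmax⟩ :=
          (e j).support.exists_max_image id (Finsupp.support_nonempty_iff.mpr h)
        refine Submodule.smul_mem _ _ (hbot m (e j) (he j) h0 hmax (lt_of_le_of_ne ?_ ?_))
        · exact (Finsupp.mem_supported R (e j)).mp (he j).2 hm
        · rintro rfl
          exact Finsupp.mem_support_iff.mp hm h0
      · exact Submodule.smul_mem _ _ (Submodule.subset_span ⟨⟨j, h0⟩, rfl⟩)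
    have hg : f - c • e j ∈ below j := sub_mem hf (Submodule.smul_mem _ _ (he j))
    have hgj : (f - c • e j) j = 0 := by
      rw [Finsupp.sub_apply, Finsupp.smul_apply, smul_eq_mul, hc, sub_self]
    have hg' : f - c • e j ∈ Submodule.span R (Set.range fun k : K => e k) := by
      rcases eq_or_ne (f - c • e j) 0 with h | h
      · rw [h]; exact zero_mem _
      obtain ⟨m, hm, hmax⟩ :=
        (f - c • e j).support.exists_max_image id (Finsupp.support_nonempty_iff.mpr h)
      refine ih m (lt_of_le_of_ne ?_ ?_) _
        ⟨hg.1, (Finsupp.mem_supported R _).mpr fun i hi => hmax i hi⟩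
      · exact (Finsupp.mem_supported R _).mp hg.2 hm
      · rintro rfl
        exact Finsupp.mem_support_iff.mp hm hgj
    have := add_mem hg' hce
    rwa [sub_add_cancel] at this
  refine Module.Free.of_basis (Module.Basis.mk hli ?_)
  rintro ⟨f, hf⟩ -
  rcases eq_or_ne f 0 with rfl | hne
  · exact zero_mem _
  obtain ⟨m, hm, hmax⟩ := f.support.exists_max_image id (Finsupp.support_nonempty_iff.mpr hne)
  have h := hspan m f ⟨hf, (Finsupp.mem_supported R f).mpr fun i hi => hmax i hi⟩
  have hmap : Submodule.span R (Set.range fun k : K => e k) =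
      (Submodule.span R (Set.range b)).map N.subtype := by
    rw [Submodule.map_span, ← Set.range_comp]
    rfl
  rw [hmap] at h
  obtain ⟨y, hy, hyf⟩ := h
  have : y = ⟨f, hf⟩ := Subtype.ext hyf
  rwa [← this]

/-- A module over a principal ideal domain that embeds in a free module is free. -/
theorem Module.Free.of_injective_to_free {R : Type u} [CommRing R] [IsDomain R]
    [IsPrincipalIdealRing R] {M : Type v} {F : Type w} [AddCommGroup M] [Module R M]
    [AddCommGroup F] [Module R F] [Module.Free R F] (f : M →ₗ[R] F)
    (hf : Function.Injective f) : Module.Free R M := by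
  let g := (Module.Free.chooseBasis R F).repr.toLinearMap ∘ₗ f
  have hg : Function.Injective g := (LinearEquiv.injective _).comp hf
  have := Submodule.free_of_le_finsupp (LinearMap.range g)
  exact Module.Free.of_equiv (LinearEquiv.ofInjective g hg).symm

/-! ### Modules over a polynomial ring given by commuting operators -/

section CommutingOperators

open MvPolynomial

variable {R : Type u} [CommRing R] {σ : Type w}

/-- An `R`-linear map that commutes with the variables is linear over the polynomial ring. -/
def LinearMap.ofMapXSMul {M N : Type*} [AddCommGroup M] [Module R M] [Module (MvPolynomial σ R) M]
    [IsScalarTower R (MvPolynomial σ R) M] [AddCommGroup N] [Module R N]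
    [Module (MvPolynomial σ R) N] [IsScalarTower R (MvPolynomial σ R) N] (f : M →ₗ[R] N)
    (h : ∀ (i : σ) (m : M), f ((X i : MvPolynomial σ R) • m) = (X i : MvPolynomial σ R) • f m) :
    M →ₗ[MvPolynomial σ R] N where
  toFun := f
  map_add' := f.map_add
  map_smul' u m := by
    change f (u • m) = u • f m
    induction u using MvPolynomial.induction_on generalizing m with
    | C r => rw [← MvPolynomial.algebraMap_eq, algebraMap_smul, algebraMap_smul, f.map_smul]
    | add p q hp hq => rw [add_smul, add_smul, map_add, hp, hq]
    | mul_X p i hp => rw [mul_smul, mul_smul, hp, h]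

/-- The algebra homomorphism from a polynomial ring that sends the variables to given commuting
endomorphisms. -/
def MvPolynomial.aevalCommute {V : Type v} [AddCommGroup V] [Module R V]
    (d : σ → Module.End R V) (h : ∀ i j, d i * d j = d j * d i) :
    MvPolynomial σ R →ₐ[R] Module.End R V :=
  letI : CommRing (Algebra.adjoin R (Set.range d)) :=
    { (inferInstance : Ring (Algebra.adjoin R (Set.range d))) with
      mul_comm := (Algebra.isMulCommutative_adjoin R (by
        rintro _ ⟨i, rfl⟩ _ ⟨j, rfl⟩
        exact h i j)).is_comm.comm }
  (Algebra.adjoin R (Set.range d)).val.comp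
    (MvPolynomial.aeval fun i => ⟨d i, Algebra.subset_adjoin ⟨i, rfl⟩⟩)

theorem MvPolynomial.aevalCommute_X {V : Type v} [AddCommGroup V] [Module R V]
    (d : σ → Module.End R V) (h : ∀ i j, d i * d j = d j * d i) (i : σ) :
    aevalCommute d h (X i) = d i := by
  simp [aevalCommute]

/-- The module `V` over the polynomial ring on which the variables act by the commuting
endomorphisms `d i`. -/
def OperatorModule {V : Type v} [AddCommGroup V] [Module R V] (d : σ → Module.End R V)
    (_h : ∀ i j, d i * d j = d j * d i) : Type v := V

namespace OperatorModule

variable {V : Type v} [AddCommGroup V] [Module R V] (d : σ → Module.End R V)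
  (h : ∀ i j, d i * d j = d j * d i)

instance : AddCommGroup (OperatorModule d h) := inferInstanceAs (AddCommGroup V)

instance : Module R (OperatorModule d h) := inferInstanceAs (Module R V)

instance : Module (MvPolynomial σ R) (OperatorModule d h) :=
  Module.compHom V (aevalCommute d h).toRingHom

/-- The identity map between `V` and the module over the polynomial ring. -/
def of : V ≃ₗ[R] OperatorModule d h := LinearEquiv.refl R V

theorem X_smul_of (i : σ) (x : V) : (X i : MvPolynomial σ R) • of d h x = of d h (d i x) := by
  change aevalCommute d h (X i) x = d i x
  rw [aevalCommute_X]

instance : IsScalarTower R (MvPolynomial σ R) (OperatorModule d h) where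
  smul_assoc r s x := by
    change aevalCommute d h (r • s) x = r • aevalCommute d h s x
    rw [map_smul]
    rfl

end OperatorModule

open TensorProduct

/-- The operator `φ ↦ X i ∘ φ - φ ∘ d i` on linear maps from `W` to a module over the
polynomial ring. -/
def homOperator {W : Type*} [AddCommGroup W] [Module R W] (d : σ → Module.End R W)
    (F : Type*) [AddCommGroup F] [Module R F] [Module (MvPolynomial σ R) F]
    [IsScalarTower R (MvPolynomial σ R) F] (i : σ) : Module.End R (W →ₗ[R] F) where
  toFun φ := Algebra.lsmul R R F (X i : MvPolynomial σ R) ∘ₗ φ - φ ∘ₗ d i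
  map_add' φ ψ := by ext; simp; abel
  map_smul' r φ := by
    ext x
    simp [smul_sub, smul_comm r (X i : MvPolynomial σ R)]

theorem homOperator_apply {W : Type*} [AddCommGroup W] [Module R W] (d : σ → Module.End R W)
    (F : Type*) [AddCommGroup F] [Module R F] [Module (MvPolynomial σ R) F]
    [IsScalarTower R (MvPolynomial σ R) F] (i : σ) (φ : W →ₗ[R] F) (x : W) :
    homOperator d F i φ x = (X i : MvPolynomial σ R) • φ x - φ (d i x) := rfl

theorem homOperator_comm {W : Type*} [AddCommGroup W] [Module R W] (d : σ → Module.End R W)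
    (hd : ∀ i j, d i * d j = d j * d i) (F : Type*) [AddCommGroup F] [Module R F]
    [Module (MvPolynomial σ R) F] [IsScalarTower R (MvPolynomial σ R) F] (i j : σ) :
    homOperator d F i * homOperator d F j = homOperator d F j * homOperator d F i := by
  ext φ x
  have h1 : d i (d j x) = d j (d i x) := LinearMap.congr_fun (hd i j) x
  simp only [Module.End.mul_apply, homOperator_apply, smul_sub, h1, smul_smul,
    mul_comm (X i : MvPolynomial σ R) (X j)]
  abel

/-- `A ⊗ W` with the diagonal action, for a projective `A` over the polynomial ring and a module
`W` that is projective over the ground ring and has commuting operators: equivariant maps from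
it lift along surjections. By adjunction, this is the lifting property of `A` for modules of
the form `Hom(W, F)`. -/
theorem exists_equivariant_lift {A W F B : Type*} [AddCommGroup A] [Module R A]
    [Module (MvPolynomial σ R) A] [IsScalarTower R (MvPolynomial σ R) A]
    [Module.Projective (MvPolynomial σ R) A] [AddCommGroup W] [Module R W] [Module.Projective R W]
    (d : σ → Module.End R W) (hd : ∀ i j, d i * d j = d j * d i)
    [AddCommGroup F] [Module R F] [Module (MvPolynomial σ R) F]
    [IsScalarTower R (MvPolynomial σ R) F] [AddCommGroup B] [Module R B]
    [Module (MvPolynomial σ R) B] [IsScalarTower R (MvPolynomial σ R) B]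
    (q : F →ₗ[MvPolynomial σ R] B) (hq : Function.Surjective q) (g : A ⊗[R] W →ₗ[R] B)
    (hg : ∀ (i : σ) (a : A) (x : W), g (((X i : MvPolynomial σ R) • a) ⊗ₜ x + a ⊗ₜ d i x) =
      (X i : MvPolynomial σ R) • g (a ⊗ₜ x)) :
    ∃ k : A ⊗[R] W →ₗ[R] F, (∀ z, q (k z) = g z) ∧
      ∀ (i : σ) (a : A) (x : W), k (((X i : MvPolynomial σ R) • a) ⊗ₜ x + a ⊗ₜ d i x) =
        (X i : MvPolynomial σ R) • k (a ⊗ₜ x) := by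
  have hF := homOperator_comm d hd F
  have hB := homOperator_comm d hd B
  -- Composition with `q`, as a map `Hom(W, F) → Hom(W, B)` over the polynomial ring.
  let qF : OperatorModule (homOperator d F) hF →ₗ[MvPolynomial σ R]
      OperatorModule (homOperator d B) hB :=
    LinearMap.ofMapXSMul
      ((OperatorModule.of (homOperator d B) hB).toLinearMap ∘ₗ
        (q.restrictScalars R).compRight R ∘ₗ
          (OperatorModule.of (homOperator d F) hF).symm.toLinearMap)
      (fun i φ => by
        obtain ⟨φ, rfl⟩ := (OperatorModule.of (homOperator d F) hF).surjective φ
        rw [OperatorModule.X_smul_of]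
        simp only [LinearMap.comp_apply, LinearEquiv.coe_coe, LinearEquiv.symm_apply_apply]
        rw [OperatorModule.X_smul_of]
        congr 1
        ext x
        simp [homOperator_apply])
  have hqF : Function.Surjective qF := by
    intro ψ
    obtain ⟨φ, hφ⟩ := Module.projective_lifting_property (q.restrictScalars R)
      ((OperatorModule.of (homOperator d B) hB).symm ψ) hq
    exact ⟨OperatorModule.of (homOperator d F) hF φ, hφ⟩
  let γ : A →ₗ[MvPolynomial σ R] OperatorModule (homOperator d B) hB :=
    LinearMap.ofMapXSMul
      ((OperatorModule.of (homOperator d B) hB).toLinearMap ∘ₗ TensorProduct.curry g)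
      (fun i a => by
        simp only [LinearMap.comp_apply, LinearEquiv.coe_coe]
        rw [OperatorModule.X_smul_of]
        congr 1
        ext x
        have := hg i a x
        rw [map_add] at this
        simp [homOperator_apply, ← this])
  obtain ⟨κ, hκ⟩ := Module.projective_lifting_property qF γ hqF
  let κ' : A →ₗ[R] W →ₗ[R] F :=
    (OperatorModule.of (homOperator d F) hF).symm.toLinearMap ∘ₗ κ.restrictScalars R
  refine ⟨TensorProduct.lift κ', fun z => ?_, fun i a x => ?_⟩
  · induction z with
    | zero => simp
    | add y z hy hz => rw [map_add, map_add, hy, hz, map_add]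
    | tmul a x =>
      exact LinearMap.congr_fun (LinearMap.congr_fun hκ a :
        (OperatorModule.of (homOperator d B) hB).symm (qF (κ a)) =
          TensorProduct.curry g a) x
  · have h1 : κ' ((X i : MvPolynomial σ R) • a) = homOperator d F i (κ' a) := by
      change (OperatorModule.of (homOperator d F) hF).symm
        (κ ((X i : MvPolynomial σ R) • a)) = _
      rw [map_smul]
      exact OperatorModule.X_smul_of (homOperator d F) hF i (κ' a)
    rw [map_add, TensorProduct.lift.tmul, TensorProduct.lift.tmul, TensorProduct.lift.tmul, h1]
    simp [homOperator_apply]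

end CommutingOperators

/-! ### Projectivity up to a multiple -/

section ProjectiveUpTo

variable {U : Type u} [CommRing U] {E : Type v} [AddCommGroup E] [Module U E]

/-- For submodules `V' ≤ V` of `E`: multiplication by `N` on `V ⧸ V'` factors through a
projective module. The factorisation is recorded by its lift `V → (V →₀ U) → V`. -/
def ProjectiveUpTo (N : ℤ) (V V' : Submodule U E) : Prop :=
  ∃ s : V →ₗ[U] (V →₀ U), (∀ x : V, (x : E) ∈ V' → s x = 0) ∧
    ∀ x : V, ((Finsupp.linearCombination U id (s x) : V) : E) - N • (x : E) ∈ V'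

/-- If `V'` and `V ⧸ V'` are projective up to `N` and `M`, then `V` is so up to `N * M`: write
`N * M * x` as `N` times the image of the lift of `x`, plus `N` times a remainder in `V'`. -/
theorem ProjectiveUpTo.of_extension {M N : ℤ} {V V' : Submodule U E} (hle : V' ≤ V)
    (h : ProjectiveUpTo M V V') (h' : ProjectiveUpTo N V' ⊥) : ProjectiveUpTo (N * M) V ⊥ := by
  obtain ⟨s, -, hs⟩ := h
  obtain ⟨s', -, hs'⟩ := h'
  let r : V →ₗ[U] V' := ((V.subtype ∘ₗ (M • LinearMap.id)) -
    V.subtype ∘ₗ Finsupp.linearCombination U id ∘ₗ s).codRestrict V' (fun x => by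
      have := neg_mem (hs x)
      rw [neg_sub] at this
      exact this)
  have hr (x : V) : (r x : E) = M • (x : E) - (Finsupp.linearCombination U id (s x) : V) := rfl
  refine ⟨N • s + Finsupp.lmapDomain U U (Submodule.inclusion hle) ∘ₗ s' ∘ₗ r,
    fun x hx => ?_, fun x => ?_⟩
  · have : x = 0 := Subtype.ext hx
    rw [this, map_zero]
  · have h1 := hs' (r x)
    rw [Submodule.mem_bot, sub_eq_zero] at h1
    have h2 (z : V' →₀ U) : ((Finsupp.linearCombination U (id : V → V)
        (Finsupp.lmapDomain U U (Submodule.inclusion hle) z) : V) : E) =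
        (Finsupp.linearCombination U (id : V' → V') z : V') := by
      rw [Finsupp.lmapDomain_apply, Finsupp.linearCombination_mapDomain]
      have h3 := Finsupp.apply_linearCombination U (Submodule.inclusion hle) (id : V' → V') z
      rw [Function.comp_id] at h3
      rw [Function.id_comp, ← h3]
      rfl
    rw [Submodule.mem_bot, LinearMap.add_apply, map_add, LinearMap.smul_apply, map_zsmul,
      Submodule.coe_add, LinearMap.comp_apply, LinearMap.comp_apply, h2, h1, hr, smul_sub,
      Submodule.coe_smul_of_tower, mul_smul]
    abel

/-- If `V` and `V ⧸ V'` are projective up to `M` and `N`, then so is `V'` up to `N * M`: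
multiplication by `N` minus the factorisation for `V ⧸ V'` maps `V` to `V'`, and it is
multiplication by `N` on `V'`. -/
theorem ProjectiveUpTo.of_quotient {M N : ℤ} {V V' : Submodule U E} (hle : V' ≤ V)
    (h : ProjectiveUpTo M V ⊥) (h' : ProjectiveUpTo N V V') : ProjectiveUpTo (N * M) V' ⊥ := by
  obtain ⟨s, -, hs⟩ := h
  obtain ⟨s', hs0, hs'⟩ := h'
  let r : V →ₗ[U] V' := ((V.subtype ∘ₗ (N • LinearMap.id)) -
    V.subtype ∘ₗ Finsupp.linearCombination U id ∘ₗ s').codRestrict V' (fun x => by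
      have := neg_mem (hs' x)
      rw [neg_sub] at this
      exact this)
  have hr (x : V) : (r x : E) = N • (x : E) - (Finsupp.linearCombination U id (s' x) : V) := rfl
  refine ⟨Finsupp.lmapDomain U U r ∘ₗ s ∘ₗ Submodule.inclusion hle, fun x hx => ?_, fun x => ?_⟩
  · have : x = 0 := Subtype.ext hx
    rw [this, map_zero]
  · have h1 := hs (Submodule.inclusion hle x)
    rw [Submodule.mem_bot, sub_eq_zero, ← Submodule.coe_smul_of_tower] at h1
    have h2 (z : V →₀ U) : Finsupp.linearCombination U (id : V' → V')
        (Finsupp.lmapDomain U U r z) = r (Finsupp.linearCombination U (id : V → V) z) := by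
      rw [Finsupp.lmapDomain_apply, Finsupp.linearCombination_mapDomain,
        Finsupp.apply_linearCombination]
      rfl
    rw [Submodule.mem_bot, LinearMap.comp_apply, LinearMap.comp_apply, h2, Subtype.ext h1,
      map_zsmul, Submodule.coe_smul_of_tower, hr, hs0 _ x.2, map_zero, Submodule.coe_zero,
      sub_zero, Submodule.coe_inclusion, mul_comm, mul_smul, sub_self]

/-- An integral combination of the two factorisations splits `(V →₀ U) → V`. -/
theorem ProjectiveUpTo.projective {M N : ℤ} {V : Submodule U E} (hMN : IsCoprime M N)
    (h : ProjectiveUpTo M V ⊥) (h' : ProjectiveUpTo N V ⊥) : Module.Projective U V := by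
  obtain ⟨s, -, hs⟩ := h
  obtain ⟨s', -, hs'⟩ := h'
  obtain ⟨a, b, hab⟩ := hMN
  refine ⟨⟨a • s + b • s', fun x => Subtype.ext ?_⟩⟩
  have h1 := hs x
  have h2 := hs' x
  rw [Submodule.mem_bot, sub_eq_zero] at h1 h2
  rw [LinearMap.add_apply, map_add, LinearMap.smul_apply, LinearMap.smul_apply, map_zsmul,
    map_zsmul, Submodule.coe_add, Submodule.coe_smul_of_tower, Submodule.coe_smul_of_tower, h1, h2,
    smul_smul, smul_smul, ← add_smul, hab, one_smul]

end ProjectiveUpTo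

section ProjectiveUpToPolynomial

open MvPolynomial TensorProduct

variable {R : Type u} [CommRing R] {σ : Type w}

/-- A factorisation through `A ⊗ W` with the diagonal action shows projectivity up to a
multiple; the second map has to be equivariant only modulo `V'`. -/
theorem ProjectiveUpTo.of_tensor {A W E : Type*} [AddCommGroup A] [Module R A]
    [Module (MvPolynomial σ R) A] [IsScalarTower R (MvPolynomial σ R) A]
    [Module.Projective (MvPolynomial σ R) A] [AddCommGroup W] [Module R W] [Module.Projective R W]
    (d : σ → Module.End R W) (hd : ∀ i j, d i * d j = d j * d i)
    [AddCommGroup E] [Module R E] [Module (MvPolynomial σ R) E]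
    [IsScalarTower R (MvPolynomial σ R) E] {V V' : Submodule (MvPolynomial σ R) E} {N : ℤ}
    (f : E →ₗ[R] A ⊗[R] W)
    (hf : ∀ (i : σ) (x : E), f ((X i : MvPolynomial σ R) • x) =
      (Algebra.lsmul R R A (X i : MvPolynomial σ R)).rTensor W (f x) + (d i).lTensor A (f x))
    (hf0 : ∀ x ∈ V', f x = 0) (g : A ⊗[R] W →ₗ[R] E) (hgV : ∀ z, g z ∈ V)
    (hg : ∀ (i : σ) (a : A) (x : W), g (((X i : MvPolynomial σ R) • a) ⊗ₜ x + a ⊗ₜ d i x) -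
      (X i : MvPolynomial σ R) • g (a ⊗ₜ x) ∈ V')
    (hgf : ∀ x ∈ V, g (f x) - N • x ∈ V') : ProjectiveUpTo N V V' := by
  let Q := V ⧸ V'.submoduleOf V
  let q : (V →₀ MvPolynomial σ R) →ₗ[MvPolynomial σ R] Q :=
    (V'.submoduleOf V).mkQ ∘ₗ Finsupp.linearCombination _ id
  have hq : Function.Surjective q := (Submodule.mkQ_surjective _).comp
    (Finsupp.linearCombination_surjective _ Function.surjective_id)
  let g' : A ⊗[R] W →ₗ[R] V := g.codRestrict (V.restrictScalars R) hgV
  obtain ⟨k, hk, hkX⟩ := exists_equivariant_lift d hd q hq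
    ((V'.submoduleOf V).mkQ.restrictScalars R ∘ₗ g') (fun i a x => by
      simp only [LinearMap.comp_apply, LinearMap.restrictScalars_apply]
      rw [← map_smul]
      exact (Submodule.Quotient.eq _).mpr (hg i a x))
  have hkX' (i : σ) (z : A ⊗[R] W) : k ((Algebra.lsmul R R A (X i : MvPolynomial σ R)).rTensor W z
      + (d i).lTensor A z) = (X i : MvPolynomial σ R) • k z := by
    induction z with
    | zero => simp
    | add y z hy hz =>
      rw [map_add k y z, smul_add, ← hy, ← hz, ← map_add, map_add (LinearMap.rTensor W _) y z,
        map_add (LinearMap.lTensor A _) y z, add_add_add_comm]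
    | tmul a x => exact hkX i a x
  refine ⟨LinearMap.ofMapXSMul (k ∘ₗ f ∘ₗ V.subtype.restrictScalars R) (fun i x => ?_),
    fun x hx => ?_, fun x => ?_⟩
  · simp only [LinearMap.comp_apply, LinearMap.restrictScalars_apply, map_smul,
      Submodule.subtype_apply]
    rw [hf, hkX']
  · change k (f x) = 0
    rw [hf0 _ hx, map_zero]
  · change ((Finsupp.linearCombination _ id (k (f x)) : V) : E) - N • (x : E) ∈ V'
    have h1 : (Finsupp.linearCombination (MvPolynomial σ R) id (k (f x)) : V) - g' (f x) ∈
        V'.submoduleOf V := (Submodule.Quotient.eq _).mp (hk (f x))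
    have h2 := add_mem (show ((Finsupp.linearCombination (MvPolynomial σ R) id (k (f x)) : V) : E) -
      g (f x) ∈ V' from h1) (hgf x x.2)
    rwa [sub_add_sub_cancel] at h2

end ProjectiveUpToPolynomial

end

noncomputable section

namespace FreeLie

/-! ### The grading of the free Lie algebra -/

section Grading

open TensorProduct

variable {R : Type u} {A : Type v} [CommRing R] [AddCommGroup A] [Module R A]

/-- `L(A)` is generated by `A`. -/
@[elab_as_elim]
theorem induction {P : FreeLie R A → Prop} (x : FreeLie R A) (hι : ∀ a, P (ι R A a))
    (zero : P 0) (add : ∀ x y, P x → P y → P (x + y)) (smul : ∀ (r : R) (x), P x → P (r • x))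
    (lie : ∀ x y, P x → P y → P ⁅x, y⁆) : P x := by
  have hx : x ∈ LieSubalgebra.lieSpan R (FreeLie R A) (Set.range (ι R A)) := by
    rw [lieSpan_range_ι]
    exact LieSubalgebra.mem_top x
  induction hx using LieSubalgebra.lieSpan_induction with
  | mem x h => obtain ⟨a, rfl⟩ := h; exact hι a
  | zero => exact zero
  | add x y _ _ hx hy => exact add x y hx hy
  | smul r x _ hx => exact smul r x hx
  | lie x y _ _ hx hy => exact lie x y hx hy

theorem ι_mem_component (a : A) : ι R A a ∈ component R A 1 :=
  leftNormed_mem_component R a []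

theorem component_zero : component R A 0 = ⊥ := by
  rw [component, Submodule.span_eq_bot]
  rintro x ⟨a, l, h, -⟩
  omega

/-- The component of degree `k + 1` is spanned by `A`, for `k = 0`, and by the brackets `⁅x, a⁆`
with `x` of degree `k`, for `k > 0`. -/
theorem component_induction {P : (k : ℕ) → FreeLie R A → Prop} {k : ℕ} {x : FreeLie R A}
    (hx : x ∈ component R A k) (hι : ∀ a, P 1 (ι R A a))
    (lie_ι : ∀ k x a, x ∈ component R A k → P k x → P (k + 1) ⁅x, ι R A a⁆)
    (zero : ∀ k, P k 0) (add : ∀ k x y, P k x → P k y → P k (x + y))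
    (smul : ∀ (k) (r : R) (x), P k x → P k (r • x)) : P k x := by
  induction hx using Submodule.span_induction with
  | mem x hx =>
    obtain ⟨a, l, rfl, rfl⟩ := hx
    induction l using List.reverseRecOn with
    | nil => exact hι a
    | append_singleton l b ih =>
      rw [leftNormed_concat, List.length_append]
      exact lie_ι _ _ _ (leftNormed_mem_component R a l) ih
  | zero => exact zero k
  | add x y _ _ hx hy => exact add k x y hx hy
  | smul r x _ hx => exact smul k r x hx

theorem lie_mem_component {i j : ℕ} {x y : FreeLie R A} (hx : x ∈ component R A i)
    (hy : y ∈ component R A j) : ⁅x, y⁆ ∈ component R A (i + j) := by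
  have key : ∀ (j : ℕ) (y : FreeLie R A), y ∈ component R A j → ⁅x, y⁆ ∈ component R A (i + j) := by
    refine component_induction (P := fun i x => ∀ (j : ℕ) (y : FreeLie R A), y ∈ component R A j →
      ⁅x, y⁆ ∈ component R A (i + j)) hx ?_ ?_ ?_ ?_ ?_
    · intro a j y hy
      rw [← lie_skew, add_comm]
      exact neg_mem (lie_ι_mem_component R hy a)
    · intro k x a _ ih j y hy
      rw [lie_lie, add_right_comm, add_assoc]
      refine sub_mem (ih _ _ ?_) ?_
      · rw [← lie_skew]
        exact neg_mem (lie_ι_mem_component R hy a)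
      · rw [← lie_skew, ← add_assoc]
        exact neg_mem (lie_ι_mem_component R (ih _ _ hy) a)
    · intro k j y _; rw [zero_lie]; exact zero_mem _
    · intro k x x' h h' j y hy; rw [add_lie]; exact add_mem (h _ _ hy) (h' _ _ hy)
    · intro k r x h j y hy; rw [smul_lie]; exact Submodule.smul_mem _ _ (h _ _ hy)
  exact key j y hy

variable (R A) in
theorem iSup_component : ⨆ k, component R A k = ⊤ := by
  rw [eq_top_iff]
  rintro x -
  refine induction x (fun a => Submodule.mem_iSup_of_mem 1 (ι_mem_component a)) (zero_mem _)
    (fun _ _ => add_mem) (fun r _ => Submodule.smul_mem _ r) fun x y hx hy => ?_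
  refine Submodule.iSup_induction (fun k => component R A k)
    (motive := fun x => ⁅x, y⁆ ∈ ⨆ k, component R A k) hx (fun i x hx => ?_) ?_ ?_
  · refine Submodule.iSup_induction (fun k => component R A k)
      (motive := fun y => ⁅x, y⁆ ∈ ⨆ k, component R A k) hy (fun j y hy => ?_) ?_ ?_
    · exact Submodule.mem_iSup_of_mem _ (lie_mem_component hx hy)
    · rw [lie_zero]; exact zero_mem _
    · intro y y' h h'; rw [lie_add]; exact add_mem h h'
  · rw [zero_lie]; exact zero_mem _
  · intro x x' h h'; rw [add_lie]; exact add_mem h h'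

theorem component_iSup_induction {motive : FreeLie R A → Prop} (x : FreeLie R A)
    (mem : ∀ k x, x ∈ component R A k → motive x) (zero : motive 0)
    (add : ∀ x y, motive x → motive y → motive (x + y)) : motive x :=
  Submodule.iSup_induction (fun k => component R A k) (motive := motive)
    (show x ∈ ⨆ k, component R A k by rw [iSup_component]; trivial) mem zero add

variable (R A) in
/-- The homomorphism `L(A) → R[t] ⊗ L(A)` that multiplies elements of degree `k` by `t ^ k`. -/
def gradingHom : FreeLie R A →ₗ⁅R⁆ Polynomial R ⊗[R] FreeLie R A :=
  lift ((TensorProduct.mk R (Polynomial R) (FreeLie R A) Polynomial.X) ∘ₗ ι R A)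

theorem gradingHom_of_mem {k : ℕ} {x : FreeLie R A} (hx : x ∈ component R A k) :
    gradingHom R A x = (Polynomial.X ^ k : Polynomial R) ⊗ₜ x := by
  refine component_induction (P := fun k x => gradingHom R A x =
    (Polynomial.X ^ k : Polynomial R) ⊗ₜ x) hx ?_ ?_ ?_ ?_ ?_
  · intro a
    simp [gradingHom]
  · intro k x a _ ih
    rw [LieHom.map_lie, ih, gradingHom, lift_ι]
    simp [pow_succ]
  · intro k; simp
  · intro k x y hx hy; rw [map_add, hx, hy, tmul_add]
  · intro k r x hx; rw [map_smul, hx, tmul_smul]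

variable (R A) in
/-- The projection of `L(A)` onto its component of degree `k`. -/
def proj (k : ℕ) : Module.End R (FreeLie R A) :=
  (TensorProduct.lid R (FreeLie R A)).toLinearMap ∘ₗ
    (Polynomial.lcoeff R k).rTensor (FreeLie R A) ∘ₗ (gradingHom R A : FreeLie R A →ₗ[R] _)

theorem proj_of_mem {k : ℕ} {x : FreeLie R A} (hx : x ∈ component R A k) : proj R A k x = x := by
  simp [proj, gradingHom_of_mem hx]

theorem proj_of_mem_ne {j k : ℕ} {x : FreeLie R A} (hx : x ∈ component R A j) (h : j ≠ k) :
    proj R A k x = 0 := by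
  simp [proj, gradingHom_of_mem hx, Polynomial.coeff_X_pow, h.symm]

theorem derivation_proj (f : A →ₗ[R] A) (k : ℕ) (x : FreeLie R A) :
    derivation f (proj R A k x) = proj R A k (derivation f x) := by
  induction x using component_iSup_induction with
  | mem j x hx =>
    rcases eq_or_ne j k with rfl | h
    · rw [proj_of_mem hx, proj_of_mem (derivation_mem_component R f hx)]
    · rw [proj_of_mem_ne hx h, proj_of_mem_ne (derivation_mem_component R f hx) h, map_zero]
  | zero => simp only [map_zero]
  | add x y hx hy => simp only [map_add, hx, hy]

end Grading

/-! ### The lower central series of the derived algebra -/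

section LowerCentral

variable (R : Type u) (A : Type v) [CommRing R] [AddCommGroup A] [Module R A]

/-- The component of degree `k` of the term `γ_{c+1}(L')` of the lower central series of the
derived algebra `L' = ⨁_{k ≥ 2} L^k(A)`; the indices start with `γ_1(L') = L'` at `c = 0`. -/
def gammaPart : ℕ → ℕ → Submodule R (FreeLie R A)
  | 0, k => if 2 ≤ k then component R A k else ⊥
  | c + 1, k => Submodule.span R {z | ∃ (i j : ℕ) (x y : FreeLie R A), 2 ≤ i ∧ i + j = k ∧
      x ∈ component R A i ∧ y ∈ gammaPart c j ∧ z = ⁅x, y⁆}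

/-- The term `γ_{c+1}(L')` of the lower central series of the derived algebra `L'` of `L(A)`. -/
def gamma (c : ℕ) : Submodule R (FreeLie R A) := ⨆ k, gammaPart R A c k

variable {R A}

theorem gammaPart_zero {k : ℕ} (hk : 2 ≤ k) : gammaPart R A 0 k = component R A k := if_pos hk

theorem gammaPart_zero_of_lt {k : ℕ} (hk : k < 2) : gammaPart R A 0 k = ⊥ :=
  if_neg (not_le.mpr hk)

theorem lie_mem_gammaPart_succ {c i j : ℕ} {x y : FreeLie R A} (hi : 2 ≤ i)
    (hx : x ∈ component R A i) (hy : y ∈ gammaPart R A c j) :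
    ⁅x, y⁆ ∈ gammaPart R A (c + 1) (i + j) :=
  Submodule.subset_span ⟨i, j, x, y, hi, rfl, hx, hy, rfl⟩

theorem gammaPart_le_gamma (c k : ℕ) : gammaPart R A c k ≤ gamma R A c :=
  le_iSup (fun k => gammaPart R A c k) k

theorem gammaPart_le_component (c k : ℕ) : gammaPart R A c k ≤ component R A k := by
  induction c generalizing k with
  | zero =>
    rcases lt_or_ge k 2 with h | h
    · rw [gammaPart_zero_of_lt h]; exact bot_le
    · rw [gammaPart_zero h]
  | succ c ih =>
    refine Submodule.span_le.mpr ?_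
    rintro _ ⟨i, j, x, y, -, rfl, hx, hy, rfl⟩
    exact lie_mem_component hx (ih j hy)

theorem gamma_induction {c : ℕ} {motive : (x : FreeLie R A) → x ∈ gamma R A c → Prop}
    (mem : ∀ k x (hx : x ∈ gammaPart R A c k), motive x (gammaPart_le_gamma c k hx))
    (zero : motive 0 (zero_mem _))
    (add : ∀ x y hx hy, motive x hx → motive y hy → motive (x + y) (add_mem hx hy))
    {x : FreeLie R A} (hx : x ∈ gamma R A c) : motive x hx :=
  Submodule.iSup_induction' (fun k => gammaPart R A c k) mem zero add hx

theorem gammaPart_succ_le (c k : ℕ) : gammaPart R A (c + 1) k ≤ gammaPart R A c k := by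
  induction c generalizing k with
  | zero =>
    refine Submodule.span_le.mpr ?_
    rintro _ ⟨i, j, x, y, hi, rfl, hx, hy, rfl⟩
    rw [gammaPart_zero (by omega)]
    exact lie_mem_component hx (gammaPart_le_component _ _ hy)
  | succ c ih =>
    refine Submodule.span_le.mpr ?_
    rintro _ ⟨i, j, x, y, hi, rfl, hx, hy, rfl⟩
    exact lie_mem_gammaPart_succ hi hx (ih j hy)

theorem gamma_succ_le (c : ℕ) : gamma R A (c + 1) ≤ gamma R A c :=
  iSup_mono fun k => gammaPart_succ_le c k

theorem gamma_add_le (c n : ℕ) : gamma R A (c + n) ≤ gamma R A c := by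
  induction n with
  | zero => exact le_rfl
  | succ n ih => exact (gamma_succ_le (c + n)).trans ih

theorem gammaPart_eq_bot {c k : ℕ} (h : k < 2 * (c + 1)) : gammaPart R A c k = ⊥ := by
  induction c generalizing k with
  | zero => exact gammaPart_zero_of_lt (by omega)
  | succ c ih =>
    refine Submodule.span_eq_bot.mpr ?_
    rintro _ ⟨i, j, x, y, hi, rfl, hx, hy, rfl⟩
    rw [ih (by omega), Submodule.mem_bot] at hy
    rw [hy, lie_zero]

/-- The case `x ∈ L'` is the definition; the general one follows by the Jacobi identity. -/
theorem lie_mem_gammaPart {c d i j : ℕ} {x y : FreeLie R A} (hx : x ∈ gammaPart R A c i)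
    (hy : y ∈ gammaPart R A d j) : ⁅x, y⁆ ∈ gammaPart R A (c + d + 1) (i + j) := by
  induction c generalizing d i j x y with
  | zero =>
    rcases lt_or_ge i 2 with h | h
    · rw [gammaPart_zero_of_lt h, Submodule.mem_bot] at hx
      rw [hx, zero_lie]; exact zero_mem _
    · rw [gammaPart_zero h] at hx
      rw [zero_add]
      exact lie_mem_gammaPart_succ h hx hy
  | succ c ih =>
    induction hx using Submodule.span_induction with
    | mem x hx =>
      obtain ⟨k, l, x, z, hk, rfl, hx, hz, rfl⟩ := hx
      rw [lie_lie]
      refine sub_mem ?_ ?_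
      · have := lie_mem_gammaPart_succ hk hx (ih hz hy)
        rwa [show c + d + 1 + 1 = c + 1 + d + 1 by ring, ← add_assoc] at this
      · have := ih hz (lie_mem_gammaPart_succ hk hx hy)
        rwa [show c + (d + 1) + 1 = c + 1 + d + 1 by ring,
          show l + (k + j) = k + l + j by ring] at this
    | zero => rw [zero_lie]; exact zero_mem _
    | add x x' _ _ h h' => rw [add_lie]; exact add_mem h h'
    | smul r x _ h => rw [smul_lie]; exact Submodule.smul_mem _ _ h

theorem lie_mem_gamma {c d : ℕ} {x y : FreeLie R A} (hx : x ∈ gamma R A c)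
    (hy : y ∈ gamma R A d) : ⁅x, y⁆ ∈ gamma R A (c + d + 1) := by
  induction hx using gamma_induction with
  | mem i x hx =>
    induction hy using gamma_induction with
    | mem j y hy => exact gammaPart_le_gamma _ _ (lie_mem_gammaPart hx hy)
    | zero => rw [lie_zero]; exact zero_mem _
    | add y y' _ _ h h' => rw [lie_add]; exact add_mem h h'
  | zero => rw [zero_lie]; exact zero_mem _
  | add x x' _ _ h h' => rw [add_lie]; exact add_mem h h'

theorem component_lie_mem_gammaPart {c i j : ℕ} {x y : FreeLie R A} (hx : x ∈ component R A i)
    (hy : y ∈ gammaPart R A c j) : ⁅x, y⁆ ∈ gammaPart R A c (i + j) := by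
  induction c generalizing j y with
  | zero =>
    rcases lt_or_ge j 2 with h | h
    · rw [gammaPart_zero_of_lt h, Submodule.mem_bot] at hy
      rw [hy, lie_zero]; exact zero_mem _
    · rw [gammaPart_zero h] at hy
      rw [gammaPart_zero (by omega)]
      exact lie_mem_component hx hy
  | succ c ih =>
    induction hy using Submodule.span_induction with
    | mem y hy =>
      obtain ⟨k, l, z, y, hk, rfl, hz, hy, rfl⟩ := hy
      rw [leibniz_lie]
      refine add_mem ?_ ?_
      · rw [← add_assoc]
        exact lie_mem_gammaPart_succ (by omega) (lie_mem_component hx hz) hy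
      · rw [add_left_comm]
        exact lie_mem_gammaPart_succ hk hz (ih hy)
    | zero => rw [lie_zero]; exact zero_mem _
    | add y y' _ _ h h' => rw [lie_add]; exact add_mem h h'
    | smul r y _ h => rw [lie_smul]; exact Submodule.smul_mem _ _ h

theorem lie_mem_gamma_right {c : ℕ} (x : FreeLie R A) {y : FreeLie R A}
    (hy : y ∈ gamma R A c) : ⁅x, y⁆ ∈ gamma R A c := by
  induction x using component_iSup_induction with
  | mem i x hx =>
    induction hy using gamma_induction with
    | mem j y hy => exact gammaPart_le_gamma _ _ (component_lie_mem_gammaPart hx hy)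
    | zero => rw [lie_zero]; exact zero_mem _
    | add y y' _ _ h h' => rw [lie_add]; exact add_mem h h'
  | zero => rw [zero_lie]; exact zero_mem _
  | add x x' h h' => rw [add_lie]; exact add_mem h h'

theorem lie_mem_gamma_zero (x y : FreeLie R A) : ⁅x, y⁆ ∈ gamma R A 0 := by
  induction x using component_iSup_induction with
  | mem i x hx =>
    induction y using component_iSup_induction with
    | mem j y hy =>
      rcases Nat.eq_zero_or_pos i with rfl | hi
      · rw [component_zero, Submodule.mem_bot] at hx
        rw [hx, zero_lie]; exact zero_mem _
      rcases Nat.eq_zero_or_pos j with rfl | hj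
      · rw [component_zero, Submodule.mem_bot] at hy
        rw [hy, lie_zero]; exact zero_mem _
      refine gammaPart_le_gamma _ (i + j) ?_
      rw [gammaPart_zero (by omega)]
      exact lie_mem_component hx hy
    | zero => rw [lie_zero]; exact zero_mem _
    | add y y' h h' => rw [lie_add]; exact add_mem h h'
  | zero => rw [zero_lie]; exact zero_mem _
  | add x x' h h' => rw [add_lie]; exact add_mem h h'

theorem derivation_mem_gammaPart (f : A →ₗ[R] A) {c k : ℕ} {x : FreeLie R A}
    (hx : x ∈ gammaPart R A c k) : derivation f x ∈ gammaPart R A c k := by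
  induction c generalizing k x with
  | zero =>
    rcases lt_or_ge k 2 with h | h
    · rw [gammaPart_zero_of_lt h, Submodule.mem_bot] at hx
      rw [hx, map_zero]; exact zero_mem _
    · rw [gammaPart_zero h] at hx ⊢
      exact derivation_mem_component R f hx
  | succ c ih =>
    induction hx using Submodule.span_induction with
    | mem x hx =>
      obtain ⟨i, j, x, y, hi, rfl, hx, hy, rfl⟩ := hx
      rw [LieDerivation.apply_lie_eq_add]
      exact add_mem (lie_mem_gammaPart_succ hi hx (ih hy))
        (lie_mem_gammaPart_succ hi (derivation_mem_component R f hx) hy)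
    | zero => rw [map_zero]; exact zero_mem _
    | add x y _ _ hx hy => rw [map_add]; exact add_mem hx hy
    | smul r x _ hx => rw [map_smul]; exact Submodule.smul_mem _ _ hx

theorem derivation_mem_gamma (f : A →ₗ[R] A) {c : ℕ} {x : FreeLie R A}
    (hx : x ∈ gamma R A c) : derivation f x ∈ gamma R A c := by
  induction hx using gamma_induction with
  | mem i x hx => exact gammaPart_le_gamma _ _ (derivation_mem_gammaPart f hx)
  | zero => rw [map_zero]; exact zero_mem _
  | add x y _ _ hx hy => rw [map_add]; exact add_mem hx hy

theorem proj_mem_gammaPart {c k : ℕ} {x : FreeLie R A} (hx : x ∈ gamma R A c) :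
    proj R A k x ∈ gammaPart R A c k := by
  induction hx using gamma_induction with
  | mem j x hx =>
    rcases eq_or_ne j k with rfl | h
    · rwa [proj_of_mem (gammaPart_le_component _ _ hx)]
    · rw [proj_of_mem_ne (gammaPart_le_component _ _ hx) h]; exact zero_mem _
  | zero => rw [map_zero]; exact zero_mem _
  | add x y _ _ hx hy => rw [map_add]; exact add_mem hx hy

theorem mem_derivedSeries_one {x : FreeLie R A} :
    x ∈ LieAlgebra.derivedSeries R (FreeLie R A) 1 ↔ x ∈ gamma R A 0 := by
  rw [LieAlgebra.derivedSeries_def, LieAlgebra.derivedSeriesOfIdeal_succ,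
    ← LieSubmodule.mem_toSubmodule, LieSubmodule.lieIdeal_oper_eq_linear_span']
  constructor
  · intro hx
    refine Submodule.span_le.mpr ?_ hx
    rintro _ ⟨y, -, z, -, rfl⟩
    exact lie_mem_gamma_zero y z
  · intro hx
    induction hx using gamma_induction with
    | mem k x hx =>
      rcases lt_or_ge k 2 with h | h
      · rw [gammaPart_zero_of_lt h, Submodule.mem_bot] at hx
        rw [hx]; exact zero_mem _
      rw [gammaPart_zero h] at hx
      refine component_induction (P := fun k x => 2 ≤ k → x ∈ Submodule.span R _) hx
        ?_ ?_ ?_ ?_ ?_ h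
      · intro a h; omega
      · intro k x a _ _ _
        exact Submodule.subset_span ⟨x, trivial, ι R A a, trivial, rfl⟩
      · intro _ _; exact zero_mem _
      · intro _ x y hx hy h; exact add_mem (hx h) (hy h)
      · intro _ r x hx h; exact Submodule.smul_mem _ _ (hx h)
    | zero => exact zero_mem _
    | add x y _ _ hx hy => exact add_mem hx hy

theorem mem_derivedSeries_two {x : FreeLie R A} :
    x ∈ LieAlgebra.derivedSeries R (FreeLie R A) 2 ↔ x ∈ gamma R A 1 := by
  rw [LieAlgebra.derivedSeries_def, LieAlgebra.derivedSeriesOfIdeal_succ,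
    ← LieSubmodule.mem_toSubmodule, LieSubmodule.lieIdeal_oper_eq_linear_span']
  constructor
  · intro hx
    refine Submodule.span_le.mpr ?_ hx
    rintro _ ⟨y, hy, z, hz, rfl⟩
    have hy' := mem_derivedSeries_one.mp hy
    have hz' := mem_derivedSeries_one.mp hz
    have h := lie_mem_gamma hy' hz'
    rwa [zero_add, zero_add] at h
  · intro hx
    refine (show gamma R A 1 ≤ _ from iSup_le fun k => Submodule.span_le.mpr ?_) hx
    rintro _ ⟨i, j, x, y, hi, rfl, hx, hy, rfl⟩
    exact Submodule.subset_span ⟨x,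
      mem_derivedSeries_one.mpr (gammaPart_le_gamma 0 i (by rwa [gammaPart_zero hi])), y,
      mem_derivedSeries_one.mpr (gammaPart_le_gamma 0 j hy), rfl⟩

end LowerCentral

/-! ### The lower central series under the polynomial action -/

section Action

variable (R : Type u) (A : Type v) (σ : Type w) [CommRing R] [AddCommGroup A] [Module R A]
  [Module (MvPolynomial σ R) A] [IsScalarTower R (MvPolynomial σ R) A]

instance : IsScalarTower R (MvPolynomial σ R) (FreeLie R A) where
  smul_assoc r u x := by
    rw [smul_def, smul_def, map_smul]
    rfl

theorem X_smul_eq_derivation (i : σ) (x : FreeLie R A) :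
    (MvPolynomial.X i : MvPolynomial σ R) • x =
      derivation (Algebra.lsmul R R A (MvPolynomial.X i : MvPolynomial σ R)) x := by
  rw [smul_def, act_X]
  rfl

/-- The component `gammaPart R A c k` as a module over the polynomial ring. -/
def gammaModule (c k : ℕ) : Submodule (MvPolynomial σ R) (FreeLie R A) where
  carrier := gammaPart R A c k
  add_mem' := add_mem
  zero_mem' := zero_mem _
  smul_mem' u _ hx := smul_mem_of_X_smul_mem R (gammaPart R A c k)
    (fun i x hx => by rw [X_smul_eq_derivation]; exact derivation_mem_gammaPart _ hx) u hx

variable {R A σ}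

theorem mem_gammaModule {c k : ℕ} {x : FreeLie R A} :
    x ∈ gammaModule R A σ c k ↔ x ∈ gammaPart R A c k := Iff.rfl

theorem gammaModule_zero {k : ℕ} (hk : 2 ≤ k) : gammaModule R A σ 0 k = liePower R A σ k := by
  ext x
  rw [mem_gammaModule, gammaPart_zero hk]
  rfl

theorem gammaModule_one (k : ℕ) : gammaModule R A σ 1 k = B R A σ k := by
  ext x
  rw [mem_gammaModule, B, Submodule.mem_inf]
  change _ ↔ x ∈ component R A k ∧ x ∈ LieAlgebra.derivedSeries R (FreeLie R A) 2
  rw [mem_derivedSeries_two]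
  refine ⟨fun hx => ⟨gammaPart_le_component _ _ hx, gammaPart_le_gamma _ _ hx⟩, fun hx => ?_⟩
  rw [← proj_of_mem hx.1]
  exact proj_mem_gammaPart hx.2

end Action

end FreeLie

end

noncomputable section

/-! ### Derivations, grading and filtration of the tensor algebra -/

namespace TensorAlgebra

open TensorProduct

variable {R : Type u} {M : Type v} [CommRing R] [AddCommGroup M] [Module R M]

variable (R M) in
/-- The component of degree `n` of the tensor algebra. -/
abbrev part (n : ℕ) : Submodule R (TensorAlgebra R M) := LinearMap.range (ι R : M →ₗ[R] _) ^ n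

theorem ι_mem_part (m : M) : ι R m ∈ part R M 1 := by
  rw [part, pow_one]
  exact ⟨m, rfl⟩

theorem mul_ι_mem_part {n : ℕ} {t : TensorAlgebra R M} (ht : t ∈ part R M n) (m : M) :
    t * ι R m ∈ part R M (n + 1) := by
  rw [part, pow_succ]
  exact Submodule.mul_mem_mul ht ⟨m, rfl⟩

theorem part_succ_induction {n : ℕ} {P : TensorAlgebra R M → Prop}
    (mul_ι : ∀ t ∈ part R M n, ∀ m, P (t * ι R m)) (add : ∀ s t, P s → P t → P (s + t))
    {t : TensorAlgebra R M} (ht : t ∈ part R M (n + 1)) : P t := by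
  rw [part, pow_succ] at ht
  refine Submodule.mul_induction_on ht ?_ add
  rintro t ht _ ⟨m, rfl⟩
  exact mul_ι t ht m

theorem mem_part_zero {t : TensorAlgebra R M} :
    t ∈ part R M 0 ↔ ∃ r, algebraMap R (TensorAlgebra R M) r = t := by
  rw [part, pow_zero, Submodule.mem_one]

theorem part_induction {P : TensorAlgebra R M → Prop}
    (mem : ∀ n, ∀ t ∈ part R M n, P t) (add : ∀ s t, P s → P t → P (s + t))
    (t : TensorAlgebra R M) : P t := by
  have ht : t ∈ ⨆ n, part R M n := by
    rw [(DirectSum.Decomposition.isInternal (part R M)).submodule_iSup_eq_top]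
    trivial
  exact Submodule.iSup_induction (part R M) (motive := P) ht mem (mem 0 0 (zero_mem _)) add

/-- Every element is a sum of a scalar and of products `t * m` with `m` in `M`. -/
theorem right_induction {P : TensorAlgebra R M → Prop}
    (algebraMap : ∀ r, P (algebraMap R _ r)) (mul_ι : ∀ t m, P (t * ι R m))
    (add : ∀ s t, P s → P t → P (s + t)) (t : TensorAlgebra R M) : P t := by
  induction t using part_induction with
  | mem n t ht =>
    rcases n with _ | n
    · obtain ⟨r, rfl⟩ := mem_part_zero.mp ht
      exact algebraMap r
    · exact part_succ_induction (fun t _ m => mul_ι t m) add ht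
  | add s t hs ht => exact add s t hs ht

/-- The homomorphism `t ↦ t + ε d(t)`, for the derivation `d` that extends `δ`. -/
def dualLift (δ : Module.End R M) :
    TensorAlgebra R M →ₐ[R] TrivSqZeroExt (TensorAlgebra R M) (TensorAlgebra R M) :=
  lift R ((TrivSqZeroExt.inlAlgHom R _ _).toLinearMap ∘ₗ ι R +
    (TrivSqZeroExt.inrHom _ (TensorAlgebra R M)).restrictScalars R ∘ₗ ι R ∘ₗ δ)

theorem dualLift_fst (δ : Module.End R M) (t : TensorAlgebra R M) : (dualLift δ t).fst = t := by
  have h : (TrivSqZeroExt.fstHom R _ _).comp (dualLift δ) = AlgHom.id R _ := by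
    ext m
    simp [dualLift]
  exact AlgHom.congr_fun h t

/-- The derivation of the tensor algebra that extends the endomorphism `δ`. -/
def extendDer (δ : Module.End R M) : Module.End R (TensorAlgebra R M) :=
  (TrivSqZeroExt.sndHom _ (TensorAlgebra R M)).restrictScalars R ∘ₗ (dualLift δ).toLinearMap

@[simp]
theorem extendDer_ι (δ : Module.End R M) (m : M) : extendDer δ (ι R m) = ι R (δ m) := by
  simp [extendDer, dualLift]

@[simp]
theorem extendDer_algebraMap (δ : Module.End R M) (r : R) :
    extendDer δ (algebraMap R _ r) = 0 := by
  simp [extendDer, TrivSqZeroExt.algebraMap_eq_inl']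

theorem extendDer_mul (δ : Module.End R M) (s t : TensorAlgebra R M) :
    extendDer δ (s * t) = s * extendDer δ t + extendDer δ s * t := by
  simp [extendDer, dualLift_fst]

theorem extendDer_add (δ δ' : Module.End R M) :
    extendDer (δ + δ') = extendDer δ + extendDer δ' := by
  ext t
  induction t using TensorAlgebra.induction with
  | algebraMap r => simp
  | ι m => simp
  | mul s t hs ht => simp only [extendDer_mul, hs, ht, LinearMap.add_apply]; noncomm_ring
  | add s t hs ht => rw [map_add, hs, ht, map_add]

theorem extendDer_smul (r : R) (δ : Module.End R M) : extendDer (r • δ) = r • extendDer δ := by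
  ext t
  induction t using TensorAlgebra.induction with
  | algebraMap r => simp
  | ι m => simp
  | mul s t hs ht => simp [extendDer_mul, hs, ht]
  | add s t hs ht => rw [map_add, hs, ht, map_add]

theorem extendDer_lie (δ δ' : Module.End R M) :
    extendDer ⁅δ, δ'⁆ = ⁅extendDer δ, extendDer δ'⁆ := by
  ext t
  simp only [Ring.lie_def, LinearMap.sub_apply, Module.End.mul_apply]
  induction t using TensorAlgebra.induction with
  | algebraMap r => simp
  | ι m => simp
  | mul s t hs ht =>
    simp only [extendDer_mul, map_add, hs, ht]
    noncomm_ring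
  | add s t hs ht => simp only [map_add, hs, ht]; abel

theorem extendDer_zero : extendDer (0 : Module.End R M) = 0 := by
  rw [← zero_smul R (0 : Module.End R M), extendDer_smul, zero_smul]

theorem extendDer_comm {δ δ' : Module.End R M} (h : δ * δ' = δ' * δ) :
    extendDer δ * extendDer δ' = extendDer δ' * extendDer δ := by
  rw [← sub_eq_zero, ← Ring.lie_def, ← extendDer_lie, Ring.lie_def, h, sub_self, extendDer_zero]

theorem extendDer_mem_part (δ : Module.End R M) {n : ℕ} {t : TensorAlgebra R M}
    (ht : t ∈ part R M n) : extendDer δ t ∈ part R M n := by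
  induction n generalizing t with
  | zero =>
    obtain ⟨r, rfl⟩ := mem_part_zero.mp ht
    rw [extendDer_algebraMap]
    exact zero_mem _
  | succ n ih =>
    refine part_succ_induction (P := fun t => extendDer δ t ∈ part R M (n + 1)) (fun t ht m => ?_)
      (fun s t hs ht => ?_) ht
    · rw [extendDer_mul, extendDer_ι]
      exact add_mem (mul_ι_mem_part ht _) (mul_ι_mem_part (ih ht) _)
    · rw [map_add]; exact add_mem hs ht

variable (R M) in
/-- The projection of the tensor algebra onto its component of degree `n`. -/
def projPart (n : ℕ) : Module.End R (TensorAlgebra R M) := GradedAlgebra.proj (part R M) n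

theorem projPart_of_mem {n : ℕ} {t : TensorAlgebra R M} (ht : t ∈ part R M n) :
    projPart R M n t = t :=
  DirectSum.decompose_of_mem_same (part R M) ht

theorem projPart_of_mem_ne {n k : ℕ} {t : TensorAlgebra R M} (ht : t ∈ part R M k)
    (h : k ≠ n) : projPart R M n t = 0 :=
  DirectSum.decompose_of_mem_ne (part R M) ht h

theorem projPart_mem (n : ℕ) (t : TensorAlgebra R M) : projPart R M n t ∈ part R M n :=
  SetLike.coe_mem (DirectSum.decompose (part R M) t n)

theorem extendDer_projPart (δ : Module.End R M) (n : ℕ) (t : TensorAlgebra R M) :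
    extendDer δ (projPart R M n t) = projPart R M n (extendDer δ t) := by
  induction t using part_induction with
  | mem k t ht =>
    rcases eq_or_ne k n with rfl | h
    · rw [projPart_of_mem ht, projPart_of_mem (extendDer_mem_part δ ht)]
    · rw [projPart_of_mem_ne ht h, projPart_of_mem_ne (extendDer_mem_part δ ht) h, map_zero]
  | add s t hs ht => simp only [map_add, hs, ht]

variable (R M) in
/-- The elements of the tensor algebra all of whose components have degree at least `n`. -/
def fil (n : ℕ) : Submodule R (TensorAlgebra R M) := ⨆ k, part R M (n + k)

@[elab_as_elim]
theorem fil_induction {n : ℕ} {motive : TensorAlgebra R M → Prop}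
    (mem : ∀ k, ∀ t ∈ part R M (n + k), motive t)
    (add : ∀ s t, motive s → motive t → motive (s + t)) {t : TensorAlgebra R M}
    (ht : t ∈ fil R M n) : motive t :=
  Submodule.iSup_induction (fun k => part R M (n + k)) (motive := motive) ht mem
    (mem 0 0 (zero_mem _)) add

theorem part_le_fil {n k : ℕ} (h : n ≤ k) : part R M k ≤ fil R M n := by
  obtain ⟨k, rfl⟩ := Nat.exists_eq_add_of_le h
  exact le_iSup (fun k => part R M (n + k)) k

theorem mul_mem_fil {m n : ℕ} {s t : TensorAlgebra R M} (hs : s ∈ fil R M m)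
    (ht : t ∈ fil R M n) : s * t ∈ fil R M (m + n) := by
  refine fil_induction (fun k s hs => ?_) (fun s s' h h' => ?_) hs
  · refine fil_induction (fun l t ht => ?_) (fun t t' h h' => ?_) ht
    · refine part_le_fil (show m + n ≤ (m + k) + (n + l) by omega) ?_
      rw [part, pow_add]
      exact Submodule.mul_mem_mul hs ht
    · rw [mul_add]; exact add_mem h h'
  · rw [add_mul]; exact add_mem h h'

theorem fil_antitone {m n : ℕ} (h : m ≤ n) : fil R M n ≤ fil R M m :=
  iSup_le fun _ => part_le_fil (by omega)

theorem extendDer_mem_fil (δ : Module.End R M) {n : ℕ} {t : TensorAlgebra R M}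
    (ht : t ∈ fil R M n) : extendDer δ t ∈ fil R M n := by
  refine fil_induction (fun k t ht => ?_) (fun s t h h' => ?_) ht
  · exact part_le_fil (Nat.le_add_right n k) (extendDer_mem_part δ ht)
  · rw [map_add]; exact add_mem h h'

theorem projPart_eq_zero {m n : ℕ} (h : m < n) {t : TensorAlgebra R M} (ht : t ∈ fil R M n) :
    projPart R M m t = 0 := by
  refine fil_induction (fun k t ht => ?_) (fun s t h h' => ?_) ht
  · exact projPart_of_mem_ne ht (by omega)
  · rw [map_add, h, h', add_zero]

theorem sub_projPart_mem_fil {n : ℕ} {t : TensorAlgebra R M} (ht : t ∈ fil R M n) :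
    t - projPart R M n t ∈ fil R M (n + 1) := by
  refine fil_induction (fun k t ht => ?_) (fun s t h h' => ?_) ht
  · rcases k with _ | k
    · rw [add_zero] at ht
      rw [projPart_of_mem ht, sub_self]; exact zero_mem _
    · rw [projPart_of_mem_ne ht (by omega), sub_zero]
      exact part_le_fil (by omega) ht
  · rw [map_add, add_sub_add_comm]; exact add_mem h h'

/-- The linear part `ιInv` of a product; `algebraMapInv` is the constant part. -/
theorem ιInv_mul (s t : TensorAlgebra R M) :
    ιInv (s * t) = algebraMapInv s • ιInv t + algebraMapInv t • ιInv s := by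
  let _ : Module Rᵐᵒᵖ M := Module.compHom _ ((RingHom.id R).fromOpposite mul_comm)
  have : IsCentralScalar R M := ⟨fun r m => rfl⟩
  have h1 : (TrivSqZeroExt.fstHom R R M).comp toTrivSqZeroExt = algebraMapInv := by
    ext m
    simp [algebraMapInv]
  have h2 (t : TensorAlgebra R M) : algebraMapInv t = (toTrivSqZeroExt t : TrivSqZeroExt R M).fst :=
    (AlgHom.congr_fun h1 t).symm
  have h3 (t : TensorAlgebra R M) : ιInv t = (toTrivSqZeroExt t : TrivSqZeroExt R M).snd := rfl
  rw [h2, h2, h3, h3, h3, map_mul, TrivSqZeroExt.snd_mul, op_smul_eq_smul]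

theorem ιInv_ι (m : M) : ιInv (ι R m) = m := ι_leftInverse m

theorem algebraMapInv_ι (m : M) : algebraMapInv (ι R m) = 0 := by
  simp [algebraMapInv]

theorem algebraMapInv_eq_zero {t : TensorAlgebra R M} (ht : t ∈ fil R M 1) :
    algebraMapInv t = 0 := by
  refine fil_induction (fun k t ht => ?_) (fun s t h h' => ?_) ht
  · rw [add_comm] at ht
    refine part_succ_induction (P := fun t => algebraMapInv t = 0) (fun t _ m => ?_)
      (fun s t hs ht => ?_) ht
    · rw [map_mul, algebraMapInv_ι, mul_zero]
    · rw [map_add, hs, ht, add_zero]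
  · rw [map_add, h, h', add_zero]

theorem ιInv_extendDer (δ : Module.End R M) {t : TensorAlgebra R M} (ht : t ∈ fil R M 1) :
    ιInv (extendDer δ t) = δ (ιInv t) := by
  refine fil_induction (fun k t ht => ?_) (fun s t h h' => ?_) ht
  · rw [add_comm] at ht
    refine part_succ_induction (P := fun t => ιInv (extendDer δ t) = δ (ιInv t)) (fun t ht m => ?_)
      (fun s t hs ht => ?_) ht
    · have h0 : algebraMapInv (extendDer δ t) = 0 := by
        rcases k with _ | k
        · obtain ⟨r, rfl⟩ := mem_part_zero.mp ht
          rw [extendDer_algebraMap, map_zero]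
        · exact algebraMapInv_eq_zero (part_le_fil (by omega) (extendDer_mem_part δ ht))
      simp [extendDer_mul, ιInv_mul, ιInv_ι, algebraMapInv_ι, h0]
    · rw [map_add, map_add, hs, ht, map_add, map_add]
  · rw [map_add, map_add, h, h', map_add, map_add]

theorem sub_ι_mem_fil {t : TensorAlgebra R M} (ht : t ∈ fil R M 1) :
    t - ι R (ιInv t) ∈ fil R M 2 := by
  refine fil_induction (fun k t ht => ?_) (fun s t h h' => ?_) ht
  · rcases k with _ | k
    · rw [part, add_zero, pow_one] at ht
      obtain ⟨m, rfl⟩ := ht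
      rw [ιInv_ι, sub_self]
      exact zero_mem _
    · have h0 : ιInv t = 0 := by
        rw [show 1 + (k + 1) = k + 1 + 1 by ring] at ht
        refine part_succ_induction (P := fun t => ιInv t = 0) (fun t ht m => ?_)
          (fun s t hs ht => ?_) ht
        · rw [ιInv_mul, algebraMapInv_ι, algebraMapInv_eq_zero (part_le_fil (by omega) ht),
            zero_smul, zero_smul, add_zero]
        · rw [map_add, hs, ht, add_zero]
      rw [h0, map_zero, sub_zero]
      exact part_le_fil (by omega) ht
  · rw [map_add, map_add, add_sub_add_comm]; exact add_mem h h'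

variable (R M) in
/-- The representation of the tensor algebra on `R × (M ⊗ T)`, which corresponds to the left
regular representation under the bijection `(r, m ⊗ t) ↦ r + t * m`. -/
def splitRep : TensorAlgebra R M →ₐ[R] Module.End R (R × M ⊗[R] TensorAlgebra R M) :=
  lift R
    { toFun := fun m =>
        (LinearMap.inr R R (M ⊗[R] TensorAlgebra R M)) ∘ₗ
          (LinearMap.coprod (LinearMap.toSpanSingleton R _ (m ⊗ₜ[R] (1 : TensorAlgebra R M)))
            ((LinearMap.mulLeft R (ι R m)).lTensor M))
      map_add' := fun m m' => by
        ext <;> simp [add_tmul, add_mul, tmul_add]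
      map_smul' := fun r m => by
        ext <;> simp [smul_tmul'] }

variable (R M) in
/-- The linear map `T → M ⊗ T` that sends `t * m` to `m ⊗ t` and vanishes on scalars. -/
def splitRight : TensorAlgebra R M →ₗ[R] M ⊗[R] TensorAlgebra R M :=
  LinearMap.snd R R _ ∘ₗ LinearMap.applyₗ (1, 0) ∘ₗ (splitRep R M).toLinearMap

@[simp]
theorem splitRight_algebraMap (r : R) : splitRight R M (algebraMap R _ r) = 0 := by
  simp [splitRight, Algebra.algebraMap_eq_smul_one]

@[simp]
theorem splitRight_mul_ι (t : TensorAlgebra R M) (m : M) :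
    splitRight R M (t * ι R m) = m ⊗ₜ t := by
  have h0 : splitRep R M (ι R m) (1, 0) = (0, m ⊗ₜ[R] (1 : TensorAlgebra R M)) := by
    simp [splitRep]
  have h1 : ∀ s, splitRep R M t (0, m ⊗ₜ s) = (0, m ⊗ₜ (t * s)) := by
    induction t using TensorAlgebra.induction with
    | algebraMap r =>
      intro s
      simp [Algebra.algebraMap_eq_smul_one]
    | ι m' => intro s; simp [splitRep]
    | mul t t' h h' => intro s; rw [map_mul, Module.End.mul_apply, h', h, mul_assoc]
    | add t t' h h' => intro s; rw [map_add, LinearMap.add_apply, h, h', add_mul, tmul_add]; simp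
  change (splitRep R M (t * ι R m) (1, 0)).2 = _
  rw [map_mul, Module.End.mul_apply, h0, h1, mul_one]

theorem splitRight_extendDer (δ : Module.End R M) (t : TensorAlgebra R M) :
    splitRight R M (extendDer δ t) =
      δ.rTensor _ (splitRight R M t) + (extendDer δ).lTensor M (splitRight R M t) := by
  induction t using right_induction with
  | algebraMap r => simp
  | mul_ι t m => simp [extendDer_mul]
  | add s t hs ht =>
    rw [map_add, map_add, hs, ht, map_add, map_add, map_add, add_add_add_comm]

end TensorAlgebra

end

noncomputable section

namespace FreeLie

open TensorProduct TensorAlgebra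

attribute [local instance] LieRing.ofAssociativeRing

/-! ### The Fox representation -/

section Fox

variable {R : Type u} {A : Type v} {Y : Type w} [CommRing R] [AddCommGroup A] [Module R A]
  [AddCommGroup Y] [Module R Y] (y : A →ₗ[R] Y) (D : A →ₗ[R] Module.End R Y)

/-- The representation of `L(A)` on the tensor algebra of `Y` in which `a` acts as the sum of the
derivation that extends `D a` and of the left multiplication by `y a`. -/
def foxRep : FreeLie R A →ₗ⁅R⁆ Module.End R (TensorAlgebra R Y) :=
  lift
    { toFun := fun a => extendDer (D a) + LinearMap.mulLeft R (TensorAlgebra.ι R (y a))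
      map_add' := fun a b => by
        ext t
        simp [extendDer_add, add_mul]
        abel
      map_smul' := fun r a => by
        ext t
        simp [extendDer_smul] }

/-- The orbit map of the unit element under the representation `foxRep`. -/
def foxMap : FreeLie R A →ₗ[R] TensorAlgebra R Y :=
  LinearMap.applyₗ (1 : TensorAlgebra R Y) ∘ₗ (foxRep y D : FreeLie R A →ₗ[R] _)

variable {D}

theorem foxRep_ι (a : A) : foxRep y D (ι R A a) =
    extendDer (D a) + LinearMap.mulLeft R (TensorAlgebra.ι R (y a)) :=
  lift_ι _ a

theorem foxMap_apply (x : FreeLie R A) : foxMap y D x = foxRep y D x 1 := rfl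

theorem extendDer_one (δ : Module.End R Y) : extendDer δ (1 : TensorAlgebra R Y) = 0 := by
  rw [← (algebraMap R (TensorAlgebra R Y)).map_one, extendDer_algebraMap]

theorem foxMap_ι (a : A) : foxMap y D (ι R A a) = TensorAlgebra.ι R (y a) := by
  rw [foxMap_apply, foxRep_ι]
  simp [extendDer_one]

theorem foxMap_lie_eq (u v : FreeLie R A) : foxMap y D ⁅u, v⁆ =
    foxRep y D u (foxMap y D v) - foxRep y D v (foxMap y D u) := by
  rw [foxMap_apply, LieHom.map_lie]
  rfl

theorem lie_mulLeft (f : Module.End R (TensorAlgebra R Y)) (t : TensorAlgebra R Y)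
    (δ : Module.End R Y) (s : TensorAlgebra R Y) (hf : f = extendDer δ + LinearMap.mulLeft R s) :
    ⁅f, LinearMap.mulLeft R t⁆ = LinearMap.mulLeft R (f t - t * s) := by
  subst hf
  ext z
  simp only [Ring.lie_def, LinearMap.sub_apply, Module.End.mul_apply, LinearMap.add_apply,
    LinearMap.mulLeft_apply, extendDer_mul]
  noncomm_ring

variable (hD : ∀ a b, D a * D b = D b * D a)

include hD

/-- Every element of `L(A)` acts as the sum of a derivation and a left multiplication. -/
theorem exists_foxRep_eq (x : FreeLie R A) :
    foxMap y D x ∈ fil R Y 1 ∧ ∃ a, foxRep y D x =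
      extendDer (D a) + LinearMap.mulLeft R (foxMap y D x) := by
  refine induction x (fun a => ⟨?_, a, ?_⟩) ?_ ?_ ?_ ?_
  · rw [foxMap_ι]
    exact part_le_fil le_rfl (ι_mem_part _)
  · rw [foxRep_ι, foxMap_ι]
  · refine ⟨by rw [map_zero]; exact zero_mem _, 0, ?_⟩
    ext t
    simp [extendDer_zero]
  · rintro x z ⟨hx, a, ha⟩ ⟨hz, b, hb⟩
    refine ⟨by rw [map_add]; exact add_mem hx hz, a + b, ?_⟩
    rw [map_add, ha, hb, map_add, extendDer_add, map_add]
    ext t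
    simp only [LinearMap.add_apply, LinearMap.mulLeft_apply, add_mul]
    abel
  · rintro r x ⟨hx, a, ha⟩
    refine ⟨by rw [map_smul]; exact Submodule.smul_mem _ _ hx, r • a, ?_⟩
    rw [map_smul, ha, map_smul, extendDer_smul, map_smul]
    ext t
    simp
  · rintro x z ⟨hx, a, ha⟩ ⟨hz, b, hb⟩
    have h0 : extendDer (D a) * extendDer (D b) = extendDer (D b) * extendDer (D a) :=
      extendDer_comm (hD a b)
    have h1 (t : TensorAlgebra R Y) :
        extendDer (D a) (extendDer (D b) t) = extendDer (D b) (extendDer (D a) t) :=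
      LinearMap.congr_fun h0 t
    refine ⟨?_, 0, ?_⟩
    · rw [foxMap_lie_eq, ha, hb]
      exact sub_mem (add_mem (extendDer_mem_fil _ hz) (fil_antitone (by omega) (mul_mem_fil hx hz)))
        (add_mem (extendDer_mem_fil _ hx) (fil_antitone (by omega) (mul_mem_fil hz hx)))
    · rw [foxMap_lie_eq, LieHom.map_lie, ha, hb, map_zero, extendDer_zero, zero_add]
      ext t
      simp only [Ring.lie_def, LinearMap.sub_apply, Module.End.mul_apply, LinearMap.add_apply,
        LinearMap.mulLeft_apply, extendDer_mul, map_add, h1]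
      noncomm_ring

theorem foxMap_mem_fil_one (x : FreeLie R A) : foxMap y D x ∈ fil R Y 1 :=
  (exists_foxRep_eq y hD x).1

theorem foxRep_lie (u v : FreeLie R A) :
    foxRep y D ⁅u, v⁆ = LinearMap.mulLeft R (foxMap y D ⁅u, v⁆) := by
  obtain ⟨-, a, ha⟩ := exists_foxRep_eq y hD u
  obtain ⟨-, b, hb⟩ := exists_foxRep_eq y hD v
  have h0 : extendDer (D a) * extendDer (D b) = extendDer (D b) * extendDer (D a) :=
      extendDer_comm (hD a b)
  have h1 (t : TensorAlgebra R Y) :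
        extendDer (D a) (extendDer (D b) t) = extendDer (D b) (extendDer (D a) t) :=
    LinearMap.congr_fun h0 t
  rw [foxMap_lie_eq, LieHom.map_lie, ha, hb]
  ext t
  simp only [Ring.lie_def, LinearMap.sub_apply, Module.End.mul_apply, LinearMap.add_apply,
    LinearMap.mulLeft_apply, extendDer_mul, map_add, h1]
  noncomm_ring

/-- Elements of the derived algebra act by left multiplications. -/
theorem foxRep_of_mem_gamma {x : FreeLie R A} (hx : x ∈ gamma R A 0) :
    foxRep y D x = LinearMap.mulLeft R (foxMap y D x) := by
  induction hx using gamma_induction with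
  | mem k x hx =>
    rcases lt_or_ge k 2 with h | h
    · rw [gammaPart_zero_of_lt h, Submodule.mem_bot] at hx
      simp [hx]
    · rw [gammaPart_zero h] at hx
      refine component_induction (P := fun k x => 2 ≤ k →
        foxRep y D x = LinearMap.mulLeft R (foxMap y D x)) hx ?_ ?_ ?_ ?_ ?_ h
      · intro a h; omega
      · intro k x a _ _ _
        exact foxRep_lie y hD x _
      · intro _ _; simp
      · intro _ x z hx hz h; ext t; simp [hx h, hz h, add_mul]
      · intro _ r x hx h; ext t; simp [hx h]
  | zero => simp
  | add x z _ _ hx hz => ext t; simp [hx, hz, add_mul]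

theorem foxMap_lie {u v : FreeLie R A} (hu : u ∈ gamma R A 0) (hv : v ∈ gamma R A 0) :
    foxMap y D ⁅u, v⁆ =
      foxMap y D u * foxMap y D v - foxMap y D v * foxMap y D u := by
  rw [foxMap_lie_eq, foxRep_of_mem_gamma y hD hu, foxRep_of_mem_gamma y hD hv]
  rfl

/-- Since `foxMap` is multiplicative on the derived algebra and maps it to positive degrees, it maps
`γ_{c+1}(L')` to degrees at least `c + 1`. -/
theorem foxMap_mem_fil {c k : ℕ} {x : FreeLie R A} (hx : x ∈ gammaPart R A c k) :
    foxMap y D x ∈ fil R Y (c + 1) := by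
  induction c generalizing k x with
  | zero => exact foxMap_mem_fil_one y hD x
  | succ c ih =>
    induction hx using Submodule.span_induction with
    | mem x hx =>
      obtain ⟨i, j, l, h, hi, rfl, hl, hh, rfl⟩ := hx
      rw [← gammaPart_zero hi] at hl
      have hh0 : h ∈ gamma R A 0 := by
        have := gamma_add_le (R := R) (A := A) 0 c
        rw [zero_add] at this
        exact this (gammaPart_le_gamma _ _ hh)
      rw [foxMap_lie y hD (gammaPart_le_gamma _ _ hl) hh0]
      have h1 := foxMap_mem_fil_one y hD l
      refine sub_mem ?_ (mul_mem_fil (ih hh) h1)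
      rw [add_comm (c + 1)]
      exact mul_mem_fil h1 (ih hh)
    | zero => rw [map_zero]; exact zero_mem _
    | add x z _ _ hx hz => rw [map_add]; exact add_mem hx hz
    | smul r x _ hx => rw [map_smul]; exact Submodule.smul_mem _ _ hx

/-- The linear part of `foxMap` on the bracket with an element of `A`. -/
theorem ιInv_foxMap_lie_ι {x : FreeLie R A} (hx : x ∈ gamma R A 0) (a : A) :
    ιInv (foxMap y D ⁅x, ι R A a⁆) = - D a (ιInv (foxMap y D x)) := by
  have h1 := foxMap_mem_fil_one y hD x
  rw [foxMap_lie_eq, foxRep_of_mem_gamma y hD hx, foxRep_ι, foxMap_ι, map_sub,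
    LinearMap.add_apply, map_add, ιInv_extendDer _ h1, LinearMap.mulLeft_apply,
    LinearMap.mulLeft_apply,
    ιInv_mul, ιInv_mul, algebraMapInv_eq_zero h1, algebraMapInv_ι]
  simp

omit hD in
theorem ιInv_foxMap_ι_lie_ι (a b : A) :
    ιInv (foxMap y D ⁅ι R A a, ι R A b⁆) = D a (y b) - D b (y a) := by
  rw [foxMap_lie_eq, foxRep_ι, foxRep_ι, foxMap_ι, foxMap_ι]
  simp [ιInv_mul, ιInv_ι, algebraMapInv_ι]

omit hD in
/-- Equivariance of `foxMap`: both sides of the identity for `foxRep` in the proof are derivations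
along `foxRep`, and agree on `A`. -/
theorem foxMap_derivation {f : A →ₗ[R] A} {δ : Module.End R Y} (hy : ∀ a, δ (y a) = y (f a))
    (hδ : ∀ a, ⁅δ, D a⁆ = D (f a)) (x : FreeLie R A) :
    foxMap y D (derivation f x) = extendDer δ (foxMap y D x) := by
  have key : foxRep y D (derivation f x) = ⁅extendDer δ, foxRep y D x⁆ := by
    refine induction x (fun a => ?_) ?_ ?_ ?_ ?_
    · rw [derivation_ι, foxRep_ι, foxRep_ι, lie_add, ← extendDer_lie, hδ,
        lie_mulLeft _ _ δ 0 (by simp)]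
      simp [hy]
    · simp
    · intro x z hx hz; rw [map_add, map_add, hx, hz, map_add, lie_add]
    · intro r x hx; rw [map_smul, map_smul, hx, map_smul, Ring.lie_def, Ring.lie_def, smul_sub,
        mul_smul_comm, smul_mul_assoc]
    · intro x z hx hz
      rw [LieDerivation.apply_lie_eq_add, map_add, LieHom.map_lie, LieHom.map_lie, hx, hz,
        LieHom.map_lie, leibniz_lie (extendDer δ), add_comm]
  rw [foxMap_apply, key, Ring.lie_def, LinearMap.sub_apply, Module.End.mul_apply,
    Module.End.mul_apply, extendDer_one, map_zero, sub_zero, ← foxMap_apply]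

end Fox

/-! ### Iterated brackets and the Dynkin operator -/

section Dynkin

variable {R : Type u} {A : Type v} {Y : Type w} [CommRing R] [AddCommGroup A] [Module R A]
  [AddCommGroup Y] [Module R Y] (r : Y →ₗ[R] FreeLie R A)

/-- The tensor algebra of `Y` acting on `L(A)`: an element `m` of `Y` acts as `ad (r m)`. -/
def adRep : TensorAlgebra R Y →ₐ[R] Module.End R (FreeLie R A) :=
  TensorAlgebra.lift R ((LieAlgebra.ad R (FreeLie R A) : FreeLie R A →ₗ[R] _) ∘ₗ r)

/-- The map `m ⊗ t ↦ t • r m`, for the action `adRep`. -/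
def bracketTensor : Y ⊗[R] TensorAlgebra R Y →ₗ[R] FreeLie R A :=
  TensorProduct.lift ((adRep r).toLinearMap.flip ∘ₗ r)

/-- The map that replaces the products in the tensor algebra by right-normed Lie products:
`m₁ ⋯ mₙ ↦ ⁅r m₁, ⁅r m₂, …, r mₙ⁆⁆`. -/
def dynkin : TensorAlgebra R Y →ₗ[R] FreeLie R A := bracketTensor r ∘ₗ splitRight R Y

@[simp]
theorem adRep_ι (m : Y) (x : FreeLie R A) : adRep r (TensorAlgebra.ι R m) x = ⁅r m, x⁆ := by
  simp [adRep]

@[simp]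
theorem bracketTensor_tmul (m : Y) (t : TensorAlgebra R Y) :
    bracketTensor r (m ⊗ₜ t) = adRep r t (r m) := rfl

theorem dynkin_mul_ι (t : TensorAlgebra R Y) (m : Y) :
    dynkin r (t * TensorAlgebra.ι R m) = adRep r t (r m) := by
  simp [dynkin]

theorem dynkin_ι (m : Y) : dynkin r (TensorAlgebra.ι R m) = r m := by
  rw [← one_mul (TensorAlgebra.ι R m), dynkin_mul_ι, map_one, Module.End.one_apply]

/-- The operator `dynkin` is a homomorphism of modules on positive degrees. -/
theorem dynkin_mul (s : TensorAlgebra R Y) {t : TensorAlgebra R Y} (ht : t ∈ fil R Y 1) :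
    dynkin r (s * t) = adRep r s (dynkin r t) := by
  refine fil_induction (fun k t ht => ?_) (fun t t' h h' => ?_) ht
  · rw [add_comm] at ht
    refine part_succ_induction (P := fun t => dynkin r (s * t) = adRep r s (dynkin r t))
      (fun t _ m => ?_) (fun t t' h h' => ?_) ht
    · rw [← mul_assoc, dynkin_mul_ι, dynkin_mul_ι, map_mul, Module.End.mul_apply]
    · rw [mul_add, map_add, h, h', map_add, map_add]
  · rw [mul_add, map_add, h, h', map_add, map_add]

variable {r} (hr : ∀ m, r m ∈ gamma R A 0)

include hr

theorem adRep_mem_gamma_of_part {n c : ℕ} {t : TensorAlgebra R Y} (ht : t ∈ part R Y n)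
    {x : FreeLie R A} (hx : x ∈ gamma R A c) : adRep r t x ∈ gamma R A (c + n) := by
  induction n generalizing t c x with
  | zero =>
    obtain ⟨s, rfl⟩ := mem_part_zero.mp ht
    rw [AlgHom.commutes]
    exact Submodule.smul_mem _ s hx
  | succ n ih =>
    refine part_succ_induction (P := fun t => adRep r t x ∈ gamma R A (c + (n + 1)))
      (fun t ht m => ?_) (fun t t' h h' => ?_) ht
    · rw [map_mul, Module.End.mul_apply, adRep_ι]
      have h1 := lie_mem_gamma (hr m) hx
      rw [zero_add] at h1
      have h2 := ih ht h1
      rwa [show c + 1 + n = c + (n + 1) by ring] at h2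
    · rw [map_add]; exact add_mem h h'

theorem adRep_mem_gamma {n c : ℕ} {t : TensorAlgebra R Y} (ht : t ∈ fil R Y n)
    {x : FreeLie R A} (hx : x ∈ gamma R A c) : adRep r t x ∈ gamma R A (c + n) := by
  refine fil_induction (fun k t ht => ?_) (fun t t' h h' => ?_) ht
  · have := adRep_mem_gamma_of_part hr ht hx
    rw [← add_assoc] at this
    exact gamma_add_le _ _ this
  · rw [map_add]; exact add_mem h h'

theorem dynkin_mem_gamma {n : ℕ} {t : TensorAlgebra R Y} (ht : t ∈ fil R Y (n + 1)) :
    dynkin r t ∈ gamma R A n := by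
  refine fil_induction (fun k t ht => ?_) (fun t t' h h' => ?_) ht
  · rw [add_right_comm] at ht
    refine part_succ_induction (P := fun t => dynkin r t ∈ gamma R A n)
      (fun t ht m => ?_) (fun t t' h h' => ?_) ht
    · rw [dynkin_mul_ι]
      have := adRep_mem_gamma hr (part_le_fil (Nat.le_add_right n k) ht) (hr m)
      rwa [zero_add] at this
    · rw [map_add]; exact add_mem h h'
  · rw [map_add]; exact add_mem h h'

/-- If `r` is equivariant modulo `γ_2(L')`, then `adRep r` is so up to one step of the series. -/
theorem derivation_adRep {f : A →ₗ[R] A} {δ : Module.End R Y}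
    (hf : ∀ m, derivation f (r m) - r (δ m) ∈ gamma R A 1) {n c : ℕ} {t : TensorAlgebra R Y}
    (ht : t ∈ part R Y n) {x : FreeLie R A} (hx : x ∈ gamma R A c) :
    derivation f (adRep r t x) - (adRep r (extendDer δ t) x + adRep r t (derivation f x)) ∈
      gamma R A (c + n + 1) := by
  induction n generalizing t c x with
  | zero =>
    obtain ⟨s, rfl⟩ := mem_part_zero.mp ht
    rw [AlgHom.commutes, extendDer_algebraMap, map_zero]
    simp [Module.algebraMap_end_apply]
  | succ n ih =>
    refine part_succ_induction (P := fun t => derivation f (adRep r t x) -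
      (adRep r (extendDer δ t) x + adRep r t (derivation f x)) ∈ gamma R A (c + (n + 1) + 1))
      (fun t ht m => ?_) (fun t t' h h' => ?_) ht
    · have h1 := lie_mem_gamma (hr m) hx
      rw [zero_add] at h1
      have h2 := ih ht h1
      have h3 := lie_mem_gamma (hf m) hx
      have h4 := adRep_mem_gamma_of_part hr ht h3
      rw [show c + 1 + n + 1 = c + (n + 1) + 1 by ring] at h2
      rw [show 1 + c + 1 + n = c + (n + 1) + 1 by ring] at h4
      have h5 := add_mem h2 h4
      have h6 : derivation f ⁅r m, x⁆ = ⁅r m, derivation f x⁆ + ⁅derivation f (r m), x⁆ :=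
        LieDerivation.apply_lie_eq_add _ _ _
      rw [extendDer_mul, extendDer_ι, map_mul, map_add, map_mul, map_mul, Module.End.mul_apply,
        Module.End.mul_apply, LinearMap.add_apply, Module.End.mul_apply, Module.End.mul_apply,
        adRep_ι, adRep_ι, adRep_ι]
      rw [h6, sub_lie, map_add, map_sub] at h5
      convert h5 using 1
      abel
    · simp only [map_add, LinearMap.add_apply]
      convert add_mem h h' using 1
      abel

variable (y : A →ₗ[R] Y) {D : A →ₗ[R] Module.End R Y} (hD : ∀ a b, D a * D b = D b * D a)

omit hr in
variable (r D) in
/-- The Dynkin relations with multiplier `n` for `x` in `γ_{c+1}(L')`, modulo `γ_{c+2}(L')`: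
`dynkin` inverts `foxMap` up to the factor `(c + 1) n ^ (c + 1)`, and `foxMap x` acts on `L(A)`
as `n ^ (c + 1) ad x`. -/
def DynkinRelation (n : ℤ) (c : ℕ) (x : FreeLie R A) : Prop :=
  (dynkin r (foxMap y D x) - ((c + 1 : ℤ) * n ^ (c + 1)) • x ∈ gamma R A (c + 1)) ∧
  ∀ m, ∀ z ∈ gamma R A m,
    adRep r (foxMap y D x) z - (n ^ (c + 1)) • ⁅x, z⁆ ∈ gamma R A (m + c + 2)

include hD

/-- For `x` in the derived algebra, the Dynkin relations follow from their linear part. -/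
theorem dynkinRelation_zero {n : ℤ} {x : FreeLie R A}
    (h : r (ιInv (foxMap y D x)) - n • x ∈ gamma R A 1) : DynkinRelation r y D n 0 x := by
  have h1 := sub_ι_mem_fil (foxMap_mem_fil_one y hD x)
  refine ⟨?_, fun m z hz => ?_⟩
  · have h2 := add_mem (dynkin_mem_gamma hr h1) h
    rw [map_sub, dynkin_ι, sub_add_sub_cancel] at h2
    simpa using h2
  · have h2 := adRep_mem_gamma hr h1 hz
    have h3 := lie_mem_gamma h hz
    rw [show 1 + m + 1 = m + 2 by ring] at h3
    have h4 := add_mem h2 h3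
    rw [map_sub, LinearMap.sub_apply, adRep_ι, sub_lie, sub_add_sub_cancel] at h4
    simpa using h4

/-- The Dynkin relations for `⁅l, h⁆`, where `foxMap ⁅l, h⁆` is a commutator of `foxMap l` and
`foxMap h`: on `foxMap l * foxMap h`, the operator `dynkin` gives `n ad l` applied to
`(c + 1) n ^ (c + 1) h`, and on `foxMap h * foxMap l` it gives `n ^ (c + 1) ad h` applied to `n l`;
the multipliers add up to `(c + 2) n ^ (c + 2)`. -/
theorem dynkinRelation_lie {n : ℤ} {c : ℕ} {l h : FreeLie R A} (hl : l ∈ gamma R A 0)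
    (hh : h ∈ gamma R A c) (hl' : DynkinRelation r y D n 0 l)
    (hh' : DynkinRelation r y D n c h) (hfil : foxMap y D h ∈ fil R Y (c + 1)) :
    DynkinRelation r y D n (c + 1) ⁅l, h⁆ := by
  have hh0 : h ∈ gamma R A 0 := by
    rw [← zero_add c] at hh
    exact gamma_add_le 0 c hh
  have hlf := foxMap_mem_fil_one y hD l
  have hhf := foxMap_mem_fil_one y hD h
  obtain ⟨hl1, hl2⟩ := hl'
  obtain ⟨hh1, hh2⟩ := hh'
  rw [DynkinRelation, foxMap_lie y hD hl hh0]
  refine ⟨?_, fun m z hz => ?_⟩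
  · have e1 := adRep_mem_gamma hr hlf hh1
    have e2 := Submodule.smul_of_tower_mem _ ((c + 1 : ℤ) * n ^ (c + 1)) (hl2 c h hh)
    have e3 := adRep_mem_gamma hr hfil hl1
    have e4 := Submodule.smul_of_tower_mem _ ((((0 : ℕ) : ℤ) + 1) * n ^ (0 + 1)) (hh2 0 l hl)
    rw [show c + 0 + 2 = c + 1 + 1 by ring] at e2
    rw [show 0 + 1 + (c + 1) = c + 1 + 1 by ring] at e3
    rw [show 0 + c + 2 = c + 1 + 1 by ring] at e4
    convert sub_mem (add_mem e1 e2) (add_mem e3 e4) using 1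
    rw [map_sub, dynkin_mul r _ hhf, dynkin_mul r _ hlf]
    simp only [map_sub, map_zsmul, smul_sub, smul_smul]
    rw [← lie_skew l h]
    simp only [smul_neg, sub_neg_eq_add, pow_succ, pow_zero, Nat.cast_zero, Nat.cast_add,
      Nat.cast_one]
    module
  · have f1 := lie_mem_gamma hh hz
    have f2 := lie_mem_gamma hl hz
    have e1 := adRep_mem_gamma hr hlf (hh2 m z hz)
    have e2 := Submodule.smul_of_tower_mem _ (n ^ (c + 1)) (hl2 _ _ f1)
    have e3 := adRep_mem_gamma hr hfil (hl2 m z hz)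
    have e4 := Submodule.smul_of_tower_mem _ (n ^ (0 + 1)) (hh2 _ _ f2)
    rw [show m + c + 2 + 1 = m + (c + 1) + 2 by ring] at e1
    rw [show c + m + 1 + 0 + 2 = m + (c + 1) + 2 by ring] at e2
    rw [show m + 0 + 2 + (c + 1) = m + (c + 1) + 2 by ring] at e3
    rw [show 0 + m + 1 + c + 2 = m + (c + 1) + 2 by ring] at e4
    convert sub_mem (add_mem e1 e2) (add_mem e3 e4) using 1
    simp only [map_sub, map_mul, LinearMap.sub_apply, Module.End.mul_apply, map_zsmul, smul_sub,
      smul_smul, lie_lie]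
    simp only [pow_succ, pow_zero]
    module

omit hr hD in
theorem dynkinRelation_add {n : ℤ} {c : ℕ} {x z : FreeLie R A} (hx : DynkinRelation r y D n c x)
    (hz : DynkinRelation r y D n c z) : DynkinRelation r y D n c (x + z) := by
  refine ⟨?_, fun m w hw => ?_⟩
  · rw [map_add, map_add, smul_add, add_sub_add_comm]
    exact add_mem hx.1 hz.1
  · rw [map_add, map_add, LinearMap.add_apply, add_lie, smul_add, add_sub_add_comm]
    exact add_mem (hx.2 m w hw) (hz.2 m w hw)

omit hr hD in
theorem dynkinRelation_smul {n : ℤ} {c : ℕ} (s : R) {x : FreeLie R A}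
    (hx : DynkinRelation r y D n c x) : DynkinRelation r y D n c (s • x) := by
  refine ⟨?_, fun m w hw => ?_⟩
  · rw [map_smul, map_smul, smul_comm, ← smul_sub]
    exact Submodule.smul_mem _ _ hx.1
  · rw [map_smul, map_smul, LinearMap.smul_apply, smul_lie, smul_comm, ← smul_sub]
    exact Submodule.smul_mem _ _ (hx.2 m w hw)

omit hr hD in
theorem dynkinRelation_zero_right (n : ℤ) (c : ℕ) :
    DynkinRelation r y D n c (0 : FreeLie R A) :=
  ⟨by simp, fun m w _ => by simp⟩

theorem dynkinRelation_of_lt {n : ℤ} {p : ℕ}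
    (h : ∀ k < p, ∀ x ∈ gammaPart R A 0 k, r (ιInv (foxMap y D x)) - n • x ∈ gamma R A 1)
    {c k : ℕ} (hk : k < p) {x : FreeLie R A} (hx : x ∈ gammaPart R A c k) :
    DynkinRelation r y D n c x := by
  induction c generalizing k x with
  | zero => exact dynkinRelation_zero hr y hD (h k hk x hx)
  | succ c ih =>
    induction hx using Submodule.span_induction with
    | mem x hx =>
      obtain ⟨i, j, u, v, hi, rfl, hu, hv, rfl⟩ := hx
      rw [← gammaPart_zero hi] at hu
      exact dynkinRelation_lie hr y hD (gammaPart_le_gamma _ _ hu) (gammaPart_le_gamma _ _ hv)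
        (dynkinRelation_zero hr y hD (h i (by omega) u hu)) (ih (by omega) hv)
        (foxMap_mem_fil y hD hv)
    | zero => exact dynkinRelation_zero_right y n _
    | add x z _ _ hx hz => exact dynkinRelation_add y hx hz
    | smul s x _ hx => exact dynkinRelation_smul y s hx

/-- In degree `k` of `γ_{c+2}(L')`, only elements of `L'` of degree less than `k` enter. -/
theorem dynkinRelation_succ {n : ℤ} {p : ℕ}
    (h : ∀ k < p, ∀ x ∈ gammaPart R A 0 k, r (ιInv (foxMap y D x)) - n • x ∈ gamma R A 1)
    {c : ℕ} {x : FreeLie R A} (hx : x ∈ gammaPart R A (c + 1) p) :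
    DynkinRelation r y D n (c + 1) x := by
  induction hx using Submodule.span_induction with
  | mem x hx =>
    obtain ⟨i, j, u, v, hi, rfl, hu, hv, rfl⟩ := hx
    rcases Nat.eq_zero_or_pos j with rfl | hj
    · rw [gammaPart_eq_bot (by omega), Submodule.mem_bot] at hv
      rw [hv, lie_zero]
      exact dynkinRelation_zero_right y n _
    rw [← gammaPart_zero hi] at hu
    exact dynkinRelation_lie hr y hD (gammaPart_le_gamma _ _ hu) (gammaPart_le_gamma _ _ hv)
      (dynkinRelation_zero hr y hD (h i (by omega) u hu))
      (dynkinRelation_of_lt hr y hD h (by omega) hv) (foxMap_mem_fil y hD hv)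
  | zero => exact dynkinRelation_zero_right y n _
  | add x z _ _ hx hz => exact dynkinRelation_add y hx hz
  | smul s x _ hx => exact dynkinRelation_smul y s hx

end Dynkin

end FreeLie

end

noncomputable section

namespace FreeLie

open TensorProduct MvPolynomial

/-! ### The metabelian quotient -/

section Metabelian

variable {R : Type u} {A : Type v} [CommRing R] [AddCommGroup A] [Module R A]

variable (R A) in
/-- The quotient `L' / L''`. -/
abbrev MetaQuotient := gamma R A 0 ⧸ (gamma R A 1).submoduleOf (gamma R A 0)

variable (R A) in
/-- The adjoint action of `A` on the derived algebra. -/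
def adDerived : A →ₗ[R] Module.End R (gamma R A 0) where
  toFun a := (LieModule.toEnd R (FreeLie R A) (FreeLie R A) (ι R A a)).restrict
    (fun x (hx : x ∈ gamma R A 0) => (lie_mem_gamma_right (ι R A a) hx :))
  map_add' a c := by ext x; simp; rfl
  map_smul' s a := by ext x; simp; rfl

theorem adDerived_apply (a : A) (x : gamma R A 0) :
    (adDerived R A a x : FreeLie R A) = ⁅ι R A a, (x : FreeLie R A)⁆ := rfl

variable (R A) in
/-- The adjoint action of `A` on `L' / L''`. -/
def adQuotient : A →ₗ[R] Module.End R (MetaQuotient R A) where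
  toFun a := Submodule.mapQ _ _ (adDerived R A a)
    (fun x (hx : (x : FreeLie R A) ∈ gamma R A 1) => lie_mem_gamma_right (ι R A a) hx)
  map_add' a c := by
    refine LinearMap.ext fun x => ?_
    obtain ⟨x, rfl⟩ := Submodule.Quotient.mk_surjective _ x
    simp; rfl
  map_smul' s a := by
    refine LinearMap.ext fun x => ?_
    obtain ⟨x, rfl⟩ := Submodule.Quotient.mk_surjective _ x
    simp; rfl

theorem adQuotient_mk (a : A) (x : gamma R A 0) :
    adQuotient R A a (Submodule.Quotient.mk x) = Submodule.Quotient.mk (adDerived R A a x) := rfl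

theorem adQuotient_comm (a c : A) :
    adQuotient R A a * adQuotient R A c = adQuotient R A c * adQuotient R A a := by
  refine LinearMap.ext fun x => ?_
  obtain ⟨x, rfl⟩ := Submodule.Quotient.mk_surjective _ x
  rw [Module.End.mul_apply, Module.End.mul_apply, adQuotient_mk, adQuotient_mk, adQuotient_mk,
    adQuotient_mk, Submodule.Quotient.eq]
  change ⁅ι R A a, ⁅ι R A c, (x : FreeLie R A)⁆⁆ - ⁅ι R A c, ⁅ι R A a, (x : FreeLie R A)⁆⁆ ∈
    gamma R A 1
  rw [← lie_lie]
  have := lie_mem_gamma (lie_mem_gamma_zero (ι R A a) (ι R A c)) x.2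
  rwa [zero_add, zero_add] at this

variable {J : Type w} (b : Module.Basis J R A)

/-- The symmetric algebra of `A`, in the form of the polynomial ring on a basis of `A`, acts on
`L' / L''` by the adjoint action. -/
abbrev MetaModule := OperatorModule (fun j => adQuotient R A (b j))
  (fun i j => adQuotient_comm (b i) (b j))

/-- The class in `L' / L''` of an element of the derived algebra. -/
def metaClass : gamma R A 0 →ₗ[R] MetaModule b :=
  (OperatorModule.of _ _).toLinearMap ∘ₗ Submodule.mkQ _

theorem metaClass_surjective : Function.Surjective (metaClass b) :=
  fun z => Submodule.mkQ_surjective _ ((OperatorModule.of (fun j => adQuotient R A (b j))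
    (fun i j => adQuotient_comm (b i) (b j))).symm z)

theorem metaClass_eq_iff {x z : gamma R A 0} :
    metaClass b x = metaClass b z ↔ (x : FreeLie R A) - z ∈ gamma R A 1 := by
  rw [metaClass, LinearMap.comp_apply, LinearMap.comp_apply, LinearEquiv.coe_coe,
    EmbeddingLike.apply_eq_iff_eq, Submodule.mkQ_apply, Submodule.mkQ_apply, Submodule.Quotient.eq]
  rfl

/-- The embedding of `A` into its symmetric algebra. -/
def lin : A →ₗ[R] MvPolynomial J R := b.constr R fun j => X j

@[simp]
theorem lin_basis (j : J) : lin b (b j) = X j := by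
  simp [lin]

theorem lin_smul (a : A) (x : gamma R A 0) :
    lin b a • metaClass b x = metaClass b (adDerived R A a x) := by
  let f : A →ₗ[R] MetaModule b :=
    (Algebra.lsmul R R (MetaModule b)).toLinearMap.flip (metaClass b x) ∘ₗ lin b
  let g : A →ₗ[R] MetaModule b := metaClass b ∘ₗ (adDerived R A).flip x
  have : f = g := b.ext fun j => by
    change lin b (b j) • metaClass b x = _
    rw [lin_basis]
    exact OperatorModule.X_smul_of (fun j => adQuotient R A (b j))
      (fun i j => adQuotient_comm (b i) (b j)) j (Submodule.Quotient.mk x)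
  exact LinearMap.congr_fun this a

/-- The class of `⁅a, c⁆` in `L' / L''`. -/
def metaBracket : A →ₗ[R] A →ₗ[R] MetaModule b :=
  LinearMap.mk₂ R (fun a c => metaClass b ⟨⁅ι R A a, ι R A c⁆, lie_mem_gamma_zero _ _⟩)
    (fun a a' c => by
      rw [← map_add]; congr 1; ext; simp)
    (fun s a c => by
      rw [← map_smul]; congr 1; ext; simp)
    (fun a c c' => by
      rw [← map_add]; congr 1; ext; simp)
    (fun s a c => by
      rw [← map_smul]; congr 1; ext; simp)

theorem metaBracket_apply (a c : A) : metaBracket b a c =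
    metaClass b ⟨⁅ι R A a, ι R A c⁆, lie_mem_gamma_zero _ _⟩ := rfl

theorem metaBracket_swap (a c : A) : metaBracket b a c = -metaBracket b c a := by
  rw [metaBracket_apply, metaBracket_apply, ← map_neg]
  congr 1
  ext
  exact (lie_skew (ι R A a) (ι R A c)).symm

/-- The derivation of the symmetric algebra with values in `L' / L''` that sends `a` to the
class of `⁅a, c⁆`. -/
def metaDer (c : A) : Derivation R (MvPolynomial J R) (MetaModule b) :=
  mkDerivation R fun j => metaBracket b (b j) c

theorem metaDer_lin (c a : A) : metaDer b c (lin b a) = metaBracket b a c := by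
  have : (metaDer b c : MvPolynomial J R →ₗ[R] MetaModule b) ∘ₗ lin b = (metaBracket b).flip c :=
    b.ext fun j => by simp [metaDer]
  exact LinearMap.congr_fun this a

/-- The map `A ⊗ S(A) → L' / L''` with
`c ⊗ a₁ ⋯ aₙ ↦ ∑ i, (∏ j ≠ i, aⱼ) • ⁅aᵢ, c⁆`. Composed with the linear part of `foxMap`, it is the
multiplication by the degree, see `contract_ιInv_foxMap`. -/
def contract : A ⊗[R] MvPolynomial J R →ₗ[R] MetaModule b :=
  TensorProduct.lift
    { toFun := fun c => (metaDer b c : MvPolynomial J R →ₗ[R] MetaModule b)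
      map_add' := fun c c' => by
        have : metaDer b (c + c') = metaDer b c + metaDer b c' :=
          derivation_ext fun j => by simp [metaDer]
        rw [this]; rfl
      map_smul' := fun s c => by
        have : metaDer b (s • c) = s • metaDer b c :=
          derivation_ext fun j => by simp [metaDer]
        rw [this]; rfl }

theorem contract_tmul (c : A) (s : MvPolynomial J R) : contract b (c ⊗ₜ s) = metaDer b c s := rfl

/-- The map `c ⊗ s ↦ s • ⁅a, c⁆`. -/
def bracketLeft (a : A) : A ⊗[R] MvPolynomial J R →ₗ[R] MetaModule b :=
  TensorProduct.lift (LinearMap.flip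
    (((LinearMap.lsmul (MvPolynomial J R) (MetaModule b)).restrictScalars₁₂ R R).compl₂
      (metaBracket b a)))

theorem bracketLeft_tmul (a c : A) (s : MvPolynomial J R) :
    bracketLeft b a (c ⊗ₜ s) = s • metaBracket b a c := rfl

/-- The embedding `a ↦ a ⊗ 1`. -/
def foxBase : A →ₗ[R] A ⊗[R] MvPolynomial J R := (TensorProduct.mk R A (MvPolynomial J R)).flip 1

/-- The action of `A` on `A ⊗ S(A)` by multiplication on the second factor. -/
def foxMul : A →ₗ[R] Module.End R (A ⊗[R] MvPolynomial J R) :=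
  LinearMap.lTensorHom A ∘ₗ LinearMap.mul R (MvPolynomial J R) ∘ₗ lin b

theorem foxMul_tmul (a c : A) (s : MvPolynomial J R) :
    foxMul b a (c ⊗ₜ s) = c ⊗ₜ (lin b a * s) := rfl

theorem foxMul_comm (a c : A) : foxMul b a * foxMul b c = foxMul b c * foxMul b a := by
  refine TensorProduct.ext' fun e s => ?_
  simp only [Module.End.mul_apply, foxMul_tmul, mul_left_comm]

theorem contract_foxMul (a : A) (z : A ⊗[R] MvPolynomial J R) :
    contract b (foxMul b a z) = lin b a • contract b z + bracketLeft b a z := by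
  induction z with
  | zero => simp
  | add z z' h h' => simp only [map_add, h, h', smul_add]; abel
  | tmul c s =>
    rw [foxMul_tmul, contract_tmul, contract_tmul, bracketLeft_tmul, Derivation.leibniz,
      metaDer_lin]

theorem bracketLeft_foxMul (a c : A) (z : A ⊗[R] MvPolynomial J R) :
    bracketLeft b a (foxMul b c z) = lin b c • bracketLeft b a z := by
  induction z with
  | zero => simp
  | add z z' h h' => simp only [map_add, h, h', smul_add]
  | tmul e s => rw [foxMul_tmul, bracketLeft_tmul, bracketLeft_tmul, mul_smul]

/-- On the linear part of `foxMap x`, the map `bracketLeft` gives the adjoint action on the class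
of `x`, and `contract` multiplies the class of `x` by the degree. In the induction on the degree,
bracketing with `a` multiplies the linear part by `-a`, and by `contract_foxMul` the map `contract`
picks up one more copy of the class. -/
theorem contract_ιInv_foxMap {k : ℕ} {x : FreeLie R A} (hx : x ∈ component R A k) (hk : 2 ≤ k)
    (h0 : x ∈ gamma R A 0) :
    (∀ a, bracketLeft b a (TensorAlgebra.ιInv (foxMap foxBase (foxMul b) x)) =
      metaClass b (adDerived R A a ⟨x, h0⟩)) ∧
    contract b (TensorAlgebra.ιInv (foxMap foxBase (foxMul b) x)) =
      (k : ℤ) • metaClass b ⟨x, h0⟩ := by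
  suffices h : ∃ h0 : x ∈ gamma R A 0,
      (∀ a, bracketLeft b a (TensorAlgebra.ιInv (foxMap foxBase (foxMul b) x)) =
        metaClass b (adDerived R A a ⟨x, h0⟩)) ∧
      contract b (TensorAlgebra.ιInv (foxMap foxBase (foxMul b) x)) =
        (k : ℤ) • metaClass b ⟨x, h0⟩ from h.2
  refine component_induction (P := fun k x => 2 ≤ k → ∃ h0 : x ∈ gamma R A 0,
    (∀ a, bracketLeft b a (TensorAlgebra.ιInv (foxMap foxBase (foxMul b) x)) =
      metaClass b (adDerived R A a ⟨x, h0⟩)) ∧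
    contract b (TensorAlgebra.ιInv (foxMap foxBase (foxMul b) x)) =
      (k : ℤ) • metaClass b ⟨x, h0⟩) hx ?_ ?_ ?_ ?_ ?_ hk
  · intro a h; omega
  · intro k x a hx ih hk
    have h0 : ⁅x, ι R A a⁆ ∈ gamma R A 0 := lie_mem_gamma_zero _ _
    refine ⟨h0, ?_⟩
    rcases Nat.lt_or_ge k 2 with hk2 | hk2
    · obtain rfl : k = 1 := by omega
      obtain ⟨c, rfl⟩ : ∃ c, ι R A c = x := by
        refine component_induction (P := fun k x => k = 1 → ∃ c, ι R A c = x) hx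
          (fun a _ => ⟨a, rfl⟩) (fun k x a hx _ h => ?_) (fun _ _ => ⟨0, map_zero _⟩) ?_ ?_ rfl
        · obtain rfl : k = 0 := by omega
          rw [component_zero, Submodule.mem_bot] at hx
          exact ⟨0, by rw [hx, zero_lie, map_zero]⟩
        · rintro _ x z hx hz h
          obtain ⟨c, rfl⟩ := hx h
          obtain ⟨e, rfl⟩ := hz h
          exact ⟨c + e, map_add _ _ _⟩
        · rintro _ s x hx h
          obtain ⟨c, rfl⟩ := hx h
          exact ⟨s • c, map_smul _ _ _⟩
      have hL (u v : A) : bracketLeft b u (foxBase v) = metaBracket b u v :=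
        one_smul (MvPolynomial J R) (metaBracket b u v)
      have hC (u : A) : contract b (foxBase u) = 0 := (metaDer b u).map_one_eq_zero
      rw [ιInv_foxMap_ι_lie_ι]
      refine ⟨fun e => ?_, ?_⟩
      · rw [map_sub, bracketLeft_foxMul, bracketLeft_foxMul, hL, hL, metaBracket_apply,
          metaBracket_apply, lin_smul, lin_smul, ← map_sub]
        congr 1
        ext
        simp only [AddSubgroupClass.coe_sub, adDerived_apply]
        rw [← lie_skew (ι R A a) ⁅ι R A e, ι R A c⁆, sub_neg_eq_add, add_comm, ← leibniz_lie]
      · rw [map_sub, contract_foxMul, contract_foxMul, hC, hC, hL, hL, smul_zero, smul_zero,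
          zero_add, zero_add, metaBracket_swap b a c, sub_neg_eq_add, metaBracket_apply]
        norm_num [two_smul]
    · obtain ⟨hx0, ih1, ih2⟩ := ih hk2
      have hneg : metaClass b ⟨⁅x, ι R A a⁆, h0⟩ = -metaClass b (adDerived R A a ⟨x, hx0⟩) := by
        rw [← map_neg]
        congr 1
        ext
        exact (lie_skew _ _).symm
      have hcomm (e : A) : metaClass b (adDerived R A e ⟨⁅x, ι R A a⁆, h0⟩) =
          -metaClass b (adDerived R A a (adDerived R A e ⟨x, hx0⟩)) := by
        rw [← lin_smul, hneg, smul_neg, ← lin_smul, ← lin_smul, ← lin_smul, smul_smul, smul_smul,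
          mul_comm]
      rw [ιInv_foxMap_lie_ι _ (foxMul_comm b) hx0]
      refine ⟨fun e => ?_, ?_⟩
      · rw [map_neg, bracketLeft_foxMul, ih1, lin_smul, hcomm]
      · rw [map_neg, contract_foxMul, ih1, ih2, smul_comm, lin_smul, hneg, smul_neg,
          Nat.cast_succ, add_smul, one_smul]
  · intro k hk
    have h00 : (⟨0, zero_mem _⟩ : gamma R A 0) = 0 := rfl
    exact ⟨zero_mem _, by simp [h00]⟩
  · intro k x z hx hz hk
    obtain ⟨hx0, hx1, hx2⟩ := hx hk
    obtain ⟨hz0, hz1, hz2⟩ := hz hk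
    have h1 : (⟨x + z, add_mem hx0 hz0⟩ : gamma R A 0) = ⟨x, hx0⟩ + ⟨z, hz0⟩ := rfl
    refine ⟨add_mem hx0 hz0, fun a => ?_, ?_⟩
    · rw [h1, map_add, map_add, map_add, hx1, hz1, map_add, map_add]
    · rw [h1, map_add, map_add, map_add, hx2, hz2, map_add, smul_add]
  · intro k s x hx hk
    obtain ⟨hx0, hx1, hx2⟩ := hx hk
    have h1 : (⟨s • x, Submodule.smul_mem _ s hx0⟩ : gamma R A 0) = s • ⟨x, hx0⟩ := rfl
    refine ⟨Submodule.smul_mem _ s hx0, fun a => ?_, ?_⟩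
    · rw [h1, map_smul, map_smul, map_smul, hx1, map_smul, map_smul]
    · rw [h1, map_smul, map_smul, map_smul, hx2, map_smul, smul_comm]

/-! ### The action of endomorphisms of `A` on the metabelian quotient -/

/-- The derivation of the symmetric algebra that extends an endomorphism of `A`. -/
def symDer (f : A →ₗ[R] A) : Derivation R (MvPolynomial J R) (MvPolynomial J R) :=
  mkDerivation R fun j => lin b (f (b j))

theorem symDer_lin (f : A →ₗ[R] A) (a : A) : symDer b f (lin b a) = lin b (f a) := by
  have : (symDer b f : MvPolynomial J R →ₗ[R] MvPolynomial J R) ∘ₗ lin b = lin b ∘ₗ f :=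
    b.ext fun j => by simp [symDer]
  exact LinearMap.congr_fun this a

theorem symDer_comm {f g : A →ₗ[R] A} (h : ∀ a, f (g a) = g (f a)) (s : MvPolynomial J R) :
    symDer b f (symDer b g s) = symDer b g (symDer b f s) := by
  have h0 : ⁅symDer b f, symDer b g⁆ = 0 := derivation_ext fun j => by
    rw [Derivation.commutator_apply, ← lin_basis b j, symDer_lin, symDer_lin, symDer_lin,
      symDer_lin, h, sub_self, Derivation.zero_apply]
  have h1 := Derivation.congr_fun h0 s
  rwa [Derivation.commutator_apply, Derivation.zero_apply, sub_eq_zero] at h1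

/-- The action of an endomorphism of `A` on `A ⊗ S(A)` by derivations. -/
def foxDer (f : A →ₗ[R] A) : Module.End R (A ⊗[R] MvPolynomial J R) :=
  f.rTensor _ + (symDer b f : MvPolynomial J R →ₗ[R] MvPolynomial J R).lTensor A

theorem foxDer_tmul (f : A →ₗ[R] A) (c : A) (s : MvPolynomial J R) :
    foxDer b f (c ⊗ₜ s) = f c ⊗ₜ s + c ⊗ₜ symDer b f s := rfl

theorem foxDer_foxBase (f : A →ₗ[R] A) (a : A) : foxDer b f (foxBase a) = foxBase (f a) := by
  change foxDer b f (a ⊗ₜ 1) = f a ⊗ₜ 1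
  rw [foxDer_tmul, Derivation.map_one_eq_zero, tmul_zero, add_zero]

theorem foxDer_lie_foxMul (f : A →ₗ[R] A) (a : A) : ⁅foxDer b f, foxMul b a⁆ = foxMul b (f a) := by
  refine TensorProduct.ext' fun c s => ?_
  rw [Ring.lie_def, LinearMap.sub_apply, Module.End.mul_apply, Module.End.mul_apply, foxMul_tmul,
    foxDer_tmul, foxDer_tmul, map_add, foxMul_tmul, foxMul_tmul, foxMul_tmul, Derivation.leibniz,
    symDer_lin, tmul_add, smul_eq_mul, smul_eq_mul, mul_comm s]
  abel

theorem foxDer_comm {f g : A →ₗ[R] A} (h : ∀ a, f (g a) = g (f a)) :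
    foxDer b f * foxDer b g = foxDer b g * foxDer b f := by
  refine TensorProduct.ext' fun c s => ?_
  simp only [Module.End.mul_apply, foxDer_tmul, map_add, h, symDer_comm b h]
  abel

/-- The action of an endomorphism of `A` on `L' / L''` by derivations. -/
def metaAct (f : A →ₗ[R] A) : Module.End R (MetaModule b) :=
  (OperatorModule.of _ _).toLinearMap ∘ₗ
    Submodule.mapQ _ _
      ((derivation f : LieDerivation R (FreeLie R A) (FreeLie R A)).toLinearMap.restrict
        fun _ hx => derivation_mem_gamma f hx)
      (fun x (hx : (x : FreeLie R A) ∈ gamma R A 1) => derivation_mem_gamma f hx) ∘ₗ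
    (OperatorModule.of _ _).symm.toLinearMap

theorem metaAct_metaClass (f : A →ₗ[R] A) (x : gamma R A 0) : metaAct b f (metaClass b x) =
    metaClass b ⟨derivation f (x : FreeLie R A), derivation_mem_gamma f x.2⟩ := rfl

theorem metaAct_metaBracket (f : A →ₗ[R] A) (a c : A) :
    metaAct b f (metaBracket b a c) = metaBracket b (f a) c + metaBracket b a (f c) := by
  rw [metaBracket_apply, metaBracket_apply, metaBracket_apply, metaAct_metaClass, ← map_add]
  congr 1
  ext
  simp only [Submodule.coe_add, LieDerivation.apply_lie_eq_add, derivation_ι]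
  rw [add_comm]

theorem metaAct_smul (f : A →ₗ[R] A) (s : MvPolynomial J R) (z : MetaModule b) :
    metaAct b f (s • z) = s • metaAct b f z + symDer b f s • z := by
  induction s using MvPolynomial.induction_on generalizing z with
  | C r =>
    rw [← MvPolynomial.algebraMap_eq, algebraMap_smul, map_smul, algebraMap_smul,
      Derivation.map_algebraMap, zero_smul, add_zero]
  | add s t hs ht => simp only [add_smul, map_add, hs, ht]; abel
  | mul_X s j hs =>
    have hX : metaAct b f ((X j : MvPolynomial J R) • z) =
        (X j : MvPolynomial J R) • metaAct b f z + symDer b f (X j) • z := by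
      obtain ⟨x, rfl⟩ := metaClass_surjective b z
      rw [metaAct_metaClass, ← lin_basis b j, symDer_lin, lin_smul, lin_smul, lin_smul,
        metaAct_metaClass, ← map_add]
      congr 1
      ext
      simp only [Submodule.coe_add, adDerived_apply, LieDerivation.apply_lie_eq_add, derivation_ι]
    rw [mul_smul, hs, hX, Derivation.leibniz, mul_smul, smul_add, add_smul, smul_smul, smul_smul,
      smul_smul, smul_eq_mul, smul_eq_mul, mul_comm (symDer b f s)]
    abel

theorem metaAct_contract (f : A →ₗ[R] A) (z : A ⊗[R] MvPolynomial J R) :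
    metaAct b f (contract b z) = contract b (foxDer b f z) := by
  induction z with
  | zero => simp
  | add z z' h h' => simp only [map_add, h, h']
  | tmul c s =>
    rw [foxDer_tmul, map_add, contract_tmul, contract_tmul, contract_tmul]
    induction s using MvPolynomial.induction_on with
    | C r => simp [← MvPolynomial.algebraMap_eq]
    | add s t hs ht => simp only [map_add, hs, ht]; abel
    | mul_X s j hs =>
      have hX (c : A) : metaDer b c (X j) = metaBracket b (b j) c := by
        rw [← lin_basis b j, metaDer_lin]
      have hd : symDer b f (X j) = lin b (f (b j)) := by rw [← lin_basis b j, symDer_lin]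
      simp only [Derivation.leibniz, map_add, metaAct_smul, hs, hX, hd, metaAct_metaBracket,
        smul_eq_mul, metaDer_lin, smul_add]
      abel

/-- A lift of `contract` to a linear map with values in the derived algebra. It is equivariant
only modulo `L''`. -/
theorem exists_contract_lift [Module.Free R A] :
    ∃ r : A ⊗[R] MvPolynomial J R →ₗ[R] FreeLie R A, (∀ z, r z ∈ gamma R A 0) ∧
      (∀ (f : A →ₗ[R] A) z, derivation f (r z) - r (foxDer b f z) ∈ gamma R A 1) ∧
      ∀ k, ∀ x ∈ gammaPart R A 0 k,
        r (TensorAlgebra.ιInv (foxMap foxBase (foxMul b) x)) - (k : ℤ) • x ∈ gamma R A 1 := by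
  obtain ⟨r, hr⟩ := Module.projective_lifting_property (metaClass b) (contract b)
    (metaClass_surjective b)
  have hr' (z) : metaClass b (r z) = contract b z := LinearMap.congr_fun hr z
  refine ⟨(gamma R A 0).subtype ∘ₗ r, fun z => (r z).2, fun f z => ?_, fun k x hx => ?_⟩
  · have h1 : metaClass b ⟨derivation f (r z : FreeLie R A), derivation_mem_gamma f (r z).2⟩ =
        metaClass b (r (foxDer b f z)) := by
      rw [← metaAct_metaClass, hr', hr', metaAct_contract]
    exact (metaClass_eq_iff b).mp h1
  · have h0 := gammaPart_le_gamma _ _ hx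
    rcases lt_or_ge k 2 with h | h
    · rw [gammaPart_zero_of_lt h, Submodule.mem_bot] at hx
      simp [hx]
    rw [gammaPart_zero h] at hx
    have h1 := (contract_ιInv_foxMap b hx h h0).2
    rw [← hr', ← map_zsmul] at h1
    exact (metaClass_eq_iff b).mp h1

end Metabelian

end FreeLie

end

noncomputable section

namespace FreeLie

open TensorProduct TensorAlgebra

attribute [local instance] LieRing.ofAssociativeRing

/-! ### Projectivity of the factors of the lower central series -/

section Factors

variable {R : Type u} {A : Type v} {σ : Type w} [CommRing R] [AddCommGroup A] [Module R A]
  [Module (MvPolynomial σ R) A] [IsScalarTower R (MvPolynomial σ R) A]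

variable (R A) in
/-- The action of a variable on `A`. -/
abbrev mulX (i : σ) : Module.End R A := Algebra.lsmul R R A (MvPolynomial.X i : MvPolynomial σ R)

theorem mulX_comm (i j : σ) (a : A) : mulX R A i (mulX R A j a) = mulX R A j (mulX R A i a) := by
  simp [smul_smul, mul_comm]

theorem adRep_ι_mem_component {n k : ℕ} {t : TensorAlgebra R A} (ht : t ∈ part R A n)
    {x : FreeLie R A} (hx : x ∈ component R A k) :
    adRep (ι R A) t x ∈ component R A (k + n) := by
  induction n generalizing t k x with
  | zero =>
    obtain ⟨s, rfl⟩ := mem_part_zero.mp ht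
    rw [AlgHom.commutes]
    exact Submodule.smul_mem _ s hx
  | succ n ih =>
    refine part_succ_induction (P := fun t => adRep (ι R A) t x ∈ component R A (k + (n + 1)))
      (fun t ht m => ?_) (fun t t' h h' => ?_) ht
    · rw [map_mul, Module.End.mul_apply, adRep_ι]
      have h1 := ih ht (lie_mem_component (ι_mem_component m) hx)
      rwa [show 1 + k + n = k + (n + 1) by ring] at h1
    · rw [map_add]; exact add_mem h h'

theorem derivation_adRep_ι (f : A →ₗ[R] A) (t : TensorAlgebra R A) (x : FreeLie R A) :
    derivation f (adRep (ι R A) t x) =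
      adRep (ι R A) (extendDer f t) x + adRep (ι R A) t (derivation f x) := by
  induction t using TensorAlgebra.induction generalizing x with
  | algebraMap r => simp [Module.algebraMap_end_apply]
  | ι m =>
    rw [adRep_ι, extendDer_ι, adRep_ι, adRep_ι, LieDerivation.apply_lie_eq_add, derivation_ι,
      add_comm]
  | mul s t hs ht =>
    simp only [map_mul, Module.End.mul_apply, extendDer_mul, map_add, LinearMap.add_apply, hs, ht]
    abel
  | add s t hs ht =>
    simp only [map_add, LinearMap.add_apply, hs, ht]
    abel

/-- The natural map from the free Lie algebra to the tensor algebra, which is the identity on `A`.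
It is the case `D = 0` of `foxMap`. -/
def toTensor : FreeLie R A →ₗ[R] TensorAlgebra R A := foxMap LinearMap.id 0

theorem toTensor_ι (a : A) : toTensor (ι R A a) = TensorAlgebra.ι R a := foxMap_ι _ a

theorem toTensor_derivation (f : A →ₗ[R] A) (x : FreeLie R A) :
    toTensor (derivation f x) = extendDer f (toTensor x) :=
  foxMap_derivation (y := (LinearMap.id : A →ₗ[R] A)) (D := (0 : A →ₗ[R] Module.End R A)) (f := f)
    (δ := f) (fun _ => rfl) (fun _ => lie_zero f) x

theorem toTensor_mem_fil_one (x : FreeLie R A) : toTensor x ∈ fil R A 1 :=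
  foxMap_mem_fil_one _ (fun _ _ => by simp) x

theorem toTensor_lie (x z : FreeLie R A) :
    toTensor ⁅x, z⁆ = toTensor x * toTensor z - toTensor z * toTensor x := by
  have hD (a c : A) : (0 : A →ₗ[R] Module.End R A) a * (0 : A →ₗ[R] Module.End R A) c =
      (0 : A →ₗ[R] Module.End R A) c * (0 : A →ₗ[R] Module.End R A) a := by simp
  obtain ⟨-, a, ha⟩ := exists_foxRep_eq (LinearMap.id : A →ₗ[R] A) hD x
  obtain ⟨-, c, hc⟩ := exists_foxRep_eq (LinearMap.id : A →ₗ[R] A) hD z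
  rw [toTensor, foxMap_lie_eq, ha, hc]
  simp [extendDer_zero]

theorem adRep_toTensor (x : FreeLie R A) :
    adRep (ι R A) (toTensor x) = LieAlgebra.ad R (FreeLie R A) x := by
  refine induction x (fun a => ?_) ?_ ?_ ?_ ?_
  · ext z
    simp [toTensor_ι]
  · simp
  · intro x z hx hz; rw [map_add, map_add, hx, hz, map_add]
  · intro s x hx; rw [map_smul, map_smul, hx, map_smul]
  · intro x z hx hz
    rw [toTensor_lie, map_sub, map_mul, map_mul, hx, hz, LieHom.map_lie, Ring.lie_def]

theorem toTensor_mem_part {k : ℕ} {x : FreeLie R A} (hx : x ∈ component R A k) :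
    toTensor x ∈ part R A k := by
  refine component_induction (P := fun k x => toTensor x ∈ part R A k) hx ?_ ?_ ?_ ?_ ?_
  · intro a
    rw [toTensor_ι]
    exact ι_mem_part a
  · intro k x a _ ih
    rw [toTensor_lie, toTensor_ι]
    refine sub_mem (mul_ι_mem_part ih a) ?_
    rw [part, pow_succ']
    exact Submodule.mul_mem_mul ⟨a, rfl⟩ ih
  · intro _; rw [map_zero]; exact zero_mem _
  · intro _ x z hx hz; rw [map_add]; exact add_mem hx hz
  · intro _ s x hx; rw [map_smul]; exact Submodule.smul_mem _ _ hx

/-- The theorem of Dynkin, Specht and Wever. -/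
theorem dynkin_toTensor {k : ℕ} {x : FreeLie R A} (hx : x ∈ component R A k) :
    dynkin (ι R A) (toTensor x) = (k : ℤ) • x := by
  refine component_induction (P := fun k x => dynkin (ι R A) (toTensor x) = (k : ℤ) • x) hx
    ?_ ?_ ?_ ?_ ?_
  · intro a
    rw [toTensor_ι, dynkin_ι, Nat.cast_one, one_smul]
  · intro k x a _ ih
    rw [toTensor_lie, toTensor_ι, map_sub, dynkin_mul_ι, dynkin_mul _ _ (toTensor_mem_fil_one x),
      ih, adRep_toTensor, adRep_ι, LieAlgebra.ad_apply, lie_zsmul, ← lie_skew x, smul_neg,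
      Nat.cast_succ, add_smul, one_smul]
    abel
  · intro _; simp
  · intro _ x z hx hz; rw [map_add, map_add, hx, hz, smul_add]
  · intro _ s x hx; rw [map_smul, map_smul, hx, smul_comm]

/-- The Lie powers are projective up to their degree: the map to the tensor power, followed by
the Dynkin operator, is the multiplication by the degree. -/
theorem projectiveUpTo_liePower [Module.Free R A] [Module.Projective (MvPolynomial σ R) A] (p : ℕ) :
    ProjectiveUpTo ((p + 1 : ℕ) : ℤ) (liePower R A σ (p + 1)) ⊥ := by
  let g : A ⊗[R] TensorAlgebra R A →ₗ[R] FreeLie R A :=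
    bracketTensor (ι R A) ∘ₗ (projPart R A p).lTensor _
  have hgT (a : A) (t : TensorAlgebra R A) :
      g (a ⊗ₜ t) = adRep (ι R A) (projPart R A p t) (ι R A a) := rfl
  have hgf (t : TensorAlgebra R A) (ht : t ∈ part R A (p + 1)) :
      g (splitRight R _ t) = dynkin (ι R A) t := by
    refine part_succ_induction (P := fun t => g (splitRight R _ t) = dynkin (ι R A) t)
      (fun t ht y => ?_) (fun t t' h h' => ?_) ht
    · rw [splitRight_mul_ι, hgT, projPart_of_mem ht, dynkin_mul_ι]
    · simp only [map_add, h, h']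
  refine ProjectiveUpTo.of_tensor (fun i => extendDer (mulX R A i))
    (fun i j => extendDer_comm (LinearMap.ext (mulX_comm i j)))
    (splitRight R A ∘ₗ toTensor) (fun i x => ?_) (fun x hx => ?_) g (fun z => ?_)
    (fun i a t => ?_) (fun x hx => ?_)
  · have h1 : toTensor ((MvPolynomial.X i : MvPolynomial σ R) • x) =
        extendDer (mulX R A i) (toTensor x) := by
      rw [X_smul_eq_derivation, toTensor_derivation]
    rw [LinearMap.comp_apply, LinearMap.comp_apply, h1]
    exact splitRight_extendDer (mulX R A i) (toTensor x)
  · rw [(Submodule.mem_bot _).mp hx, map_zero]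
  · change g z ∈ component R A (p + 1)
    induction z with
    | zero => rw [map_zero]; exact zero_mem _
    | add z z' h h' => rw [map_add]; exact add_mem h h'
    | tmul a t =>
      rw [add_comm]
      exact adRep_ι_mem_component (projPart_mem p t) (ι_mem_component a)
  · rw [Submodule.mem_bot, map_add, hgT, hgT, hgT, X_smul_eq_derivation, derivation_adRep_ι,
      derivation_ι, ← extendDer_projPart, sub_eq_zero, add_comm]
    rfl
  · change g (splitRight R A (toTensor x)) - ((p + 1 : ℕ) : ℤ) • x = 0
    rw [hgf _ (toTensor_mem_part hx), dynkin_toTensor hx, sub_self]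

variable {J : Type*} (b : Module.Basis J R A)

/-- A factor `γ_{c+1}(L') / γ_{c+2}(L')` in degree `p` is projective up to the multiplier in the
Dynkin relation: for `Y = A ⊗ S(A)`, the component of degree `c + 1` of `foxMap`, followed by the
Dynkin operator, is the multiplication by it. The tensor power of degree `c + 1` of `Y` lies in
`Y ⊗ T(Y) ≃ A ⊗ (S(A) ⊗ T(Y))`, which has the form required by `ProjectiveUpTo.of_tensor`. -/
theorem projectiveUpTo_gammaModule [Module.Free R A] [Module.Projective (MvPolynomial σ R) A]
    {p c : ℕ} {n : ℤ} (r : A ⊗[R] MvPolynomial J R →ₗ[R] FreeLie R A)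
    (hr : ∀ z, r z ∈ gamma R A 0)
    (hf : ∀ (f : A →ₗ[R] A) z, derivation f (r z) - r (foxDer b f z) ∈ gamma R A 1)
    (h : ∀ x ∈ gammaPart R A c p, DynkinRelation r foxBase (foxMul b) n c x) :
    ProjectiveUpTo ((c + 1) * n ^ (c + 1)) (gammaModule R A σ c p)
      (gammaModule R A σ (c + 1) p) := by
  let S := MvPolynomial J R
  let T := TensorAlgebra R (A ⊗[R] S)
  let φ : FreeLie R A →ₗ[R] T := foxMap foxBase (foxMul b)
  -- The action of the variables on `S ⊗ T`, for which `A ⊗ (S ⊗ T)` has the diagonal action.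
  let d (i : σ) : Module.End R (S ⊗[R] T) :=
    (symDer b (mulX R A i) : S →ₗ[R] S).rTensor T +
      (extendDer (foxDer b (mulX R A i))).lTensor S
  have hd (i j : σ) : d i * d j = d j * d i := by
    refine TensorProduct.ext' fun s t => ?_
    have h1 := extendDer_comm (foxDer_comm b (mulX_comm (R := R) (A := A) i j))
    have h2 (t : T) : extendDer (foxDer b (mulX R A i)) (extendDer (foxDer b (mulX R A j)) t) =
        extendDer (foxDer b (mulX R A j)) (extendDer (foxDer b (mulX R A i)) t) :=
      LinearMap.congr_fun h1 t
    have h3 := symDer_comm b (mulX_comm (R := R) (A := A) i j) s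
    simp only [d, Module.End.mul_apply, LinearMap.add_apply, LinearMap.rTensor_tmul,
      LinearMap.lTensor_tmul, map_add, Derivation.coeFn_coe, h2, h3]
    abel
  let e := TensorProduct.assoc R A S T
  have he (i : σ) (z : (A ⊗[R] S) ⊗[R] T) :
      e ((foxDer b (mulX R A i)).rTensor T z + (extendDer (foxDer b (mulX R A i))).lTensor _ z) =
        (mulX R A i).rTensor _ (e z) + (d i).lTensor A (e z) := by
    induction z with
    | zero => simp
    | add z z' h h' =>
      simp only [map_add] at h h' ⊢
      rw [add_add_add_comm, h, h']
      abel
    | tmul y t =>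
      induction y with
      | zero => simp
      | add y y' h h' =>
        simp only [add_tmul, map_add] at h h' ⊢
        rw [add_add_add_comm, h, h']
        abel
      | tmul a s =>
        have h1 : foxDer b (mulX R A i) (a ⊗ₜ[R] s : A ⊗[R] S) =
            mulX R A i a ⊗ₜ[R] s + a ⊗ₜ[R] symDer b (mulX R A i) s := foxDer_tmul b _ a s
        simp only [LinearMap.rTensor_tmul, LinearMap.lTensor_tmul, h1, add_tmul, map_add, e,
          TensorProduct.assoc_tmul, d, LinearMap.add_apply, tmul_add, Derivation.coeFn_coe]
        abel
  -- The Dynkin operator, restricted to degree `c + 1` in `T(Y)` and to degree `p` in `L(A)`.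
  let g : (A ⊗[R] S) ⊗[R] T →ₗ[R] FreeLie R A :=
    proj R A p ∘ₗ bracketTensor r ∘ₗ (projPart R (A ⊗[R] S) c).lTensor _
  have hgT (y : A ⊗[R] S) (t : T) : g (y ⊗ₜ t) = proj R A p (adRep r (projPart R _ c t) (r y)) :=
    rfl
  have hgX (i : σ) (z : (A ⊗[R] S) ⊗[R] T) :
      g ((foxDer b (mulX R A i)).rTensor T z + (extendDer (foxDer b (mulX R A i))).lTensor _ z) -
        derivation (mulX R A i) (g z) ∈ gammaPart R A (c + 1) p := by
    induction z with
    | zero => simp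
    | add z z' h h' =>
      convert add_mem h h' using 1
      simp only [map_add]
      abel
    | tmul y t =>
      have h1 := derivation_adRep hr (hf (mulX R A i)) (projPart_mem c t) (hr y)
      have h2 := adRep_mem_gamma_of_part hr (projPart_mem c t) (hf (mulX R A i) y)
      rw [zero_add] at h1
      rw [add_comm] at h2
      have h3 := proj_mem_gammaPart (k := p) (neg_mem (add_mem h1 h2))
      rw [LinearMap.rTensor_tmul, LinearMap.lTensor_tmul, map_add, hgT, hgT, hgT, derivation_proj,
        ← extendDer_projPart, ← map_add, ← map_sub]
      convert h3 using 2
      rw [map_sub]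
      abel
  have hgf (t : T) (ht : t ∈ part R (A ⊗[R] S) (c + 1)) :
      g (splitRight R _ t) = proj R A p (dynkin r t) := by
    refine part_succ_induction (P := fun t => g (splitRight R _ t) = proj R A p (dynkin r t))
      (fun t ht y => ?_) (fun t t' h h' => ?_) ht
    · rw [splitRight_mul_ι, hgT, projPart_of_mem ht, dynkin_mul_ι]
    · simp only [map_add, h, h']
  have hgV (z : (A ⊗[R] S) ⊗[R] T) : g z ∈ gammaPart R A c p := by
    induction z with
    | zero => rw [map_zero]; exact zero_mem _
    | add z z' h h' => rw [map_add]; exact add_mem h h'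
    | tmul y t =>
      have h1 := adRep_mem_gamma_of_part hr (projPart_mem c t) (hr y)
      rw [zero_add] at h1
      exact proj_mem_gammaPart h1
  have hD := foxMul_comm b
  refine ProjectiveUpTo.of_tensor d hd
    (e.toLinearMap ∘ₗ splitRight R _ ∘ₗ projPart R _ (c + 1) ∘ₗ φ) (fun i x => ?_)
    (fun x hx => ?_) (g ∘ₗ e.symm.toLinearMap) (fun z => hgV _) (fun i a w => ?_) (fun x hx => ?_)
  · have h1 : φ ((MvPolynomial.X i : MvPolynomial σ R) • x) =
        extendDer (foxDer b (mulX R A i)) (φ x) := by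
      rw [X_smul_eq_derivation]
      exact foxMap_derivation _ (foxDer_foxBase b _) (foxDer_lie_foxMul b _) x
    simp only [LinearMap.comp_apply, h1, ← extendDer_projPart]
    rw [show splitRight R (A ⊗[R] S) (extendDer _ _) = _ from splitRight_extendDer _ _]
    exact he i _
  · have h1 := foxMap_mem_fil foxBase hD (mem_gammaModule.mp hx)
    simp only [LinearMap.comp_apply]
    rw [show projPart R _ (c + 1) (φ x) = 0 from projPart_eq_zero (Nat.lt_succ_self _) h1, map_zero,
      map_zero]
  · rw [mem_gammaModule, X_smul_eq_derivation]
    have h1 := hgX i (e.symm (a ⊗ₜ w))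
    have h2 := he i (e.symm (a ⊗ₜ w))
    rw [LinearEquiv.apply_symm_apply, ← LinearEquiv.eq_symm_apply] at h2
    rw [h2] at h1
    exact h1
  · have hx' := mem_gammaModule.mp hx
    have h1 := foxMap_mem_fil foxBase hD hx'
    have h2 := dynkin_mem_gamma hr (sub_projPart_mem_fil h1)
    have h3 := proj_mem_gammaPart (k := p) (sub_mem (h x hx').1 h2)
    rw [mem_gammaModule]
    simp only [LinearMap.comp_apply, LinearEquiv.coe_coe, LinearEquiv.symm_apply_apply]
    rw [hgf _ (projPart_mem _ _)]
    convert h3 using 1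
    simp only [map_sub, map_zsmul, proj_of_mem (gammaPart_le_component _ _ hx')]
    abel

end Factors

end FreeLie

end

noncomputable section

namespace FreeLie

open TensorProduct TensorAlgebra

/-! ### Multipliers prime to the degree -/

section Multiplier

variable {R : Type u} {A : Type v} {σ : Type w} [CommRing R] [AddCommGroup A] [Module R A]

variable (R A) in
/-- The operator that multiplies the component of degree `k < p` by `(p - 1)! / k`, and annihilates
the components of degree at least `p`. (The component of degree `0` is zero, so that the junk value
`(p - 1)! / 0` is harmless.) -/
def degreeScaling (p : ℕ) : Module.End R (FreeLie R A) :=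
  ∑ k ∈ Finset.range p, (((p - 1).factorial / k : ℕ) : ℤ) • proj R A k

theorem degreeScaling_apply (p : ℕ) (x : FreeLie R A) : degreeScaling R A p x =
    ∑ k ∈ Finset.range p, (((p - 1).factorial / k : ℕ) : ℤ) • proj R A k x := by
  simp [degreeScaling, LinearMap.sum_apply]

theorem degreeScaling_of_mem {p k : ℕ} (hk : k < p) {x : FreeLie R A} (hx : x ∈ component R A k) :
    degreeScaling R A p x = (((p - 1).factorial / k : ℕ) : ℤ) • x := by
  rw [degreeScaling_apply, Finset.sum_eq_single k, proj_of_mem hx]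
  · intro j _ hj
    rw [proj_of_mem_ne hx hj.symm, smul_zero]
  · intro h
    exact absurd (Finset.mem_range.mpr hk) h

theorem degreeScaling_mem_gamma (p : ℕ) {c : ℕ} {x : FreeLie R A} (hx : x ∈ gamma R A c) :
    degreeScaling R A p x ∈ gamma R A c := by
  rw [degreeScaling_apply]
  exact sum_mem fun k _ => zsmul_mem (gammaPart_le_gamma c k (proj_mem_gammaPart hx)) _

theorem derivation_degreeScaling (f : A →ₗ[R] A) (p : ℕ) (x : FreeLie R A) :
    derivation f (degreeScaling R A p x) = degreeScaling R A p (derivation f x) := by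
  simp only [degreeScaling_apply, map_sum, map_zsmul, derivation_proj]

/-- Rescaling the degrees turns the multiplier `k` of a contraction in degree `k < p` into the
multiplier `(p - 1)!`, which does not depend on the degree. -/
theorem degreeScaling_sub_mem_gamma {p k : ℕ} (hk : k < p) {x y : FreeLie R A}
    (hx : x ∈ gammaPart R A 0 k) (h : y - (k : ℤ) • x ∈ gamma R A 1) :
    degreeScaling R A p y - ((p - 1).factorial : ℤ) • x ∈ gamma R A 1 := by
  have h1 := degreeScaling_mem_gamma p h
  rw [map_sub, map_zsmul, degreeScaling_of_mem hk (gammaPart_le_component _ _ hx), smul_smul] at h1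
  rcases Nat.eq_zero_or_pos k with rfl | hk0
  · rw [gammaPart_zero_of_lt (by norm_num), Submodule.mem_bot] at hx
    simpa [hx] using h1
  · rwa [← Nat.cast_mul, Nat.mul_div_cancel' (Nat.dvd_factorial hk0 (by omega))] at h1

variable [Module (MvPolynomial σ R) A] [IsScalarTower R (MvPolynomial σ R) A]
  [Module.Free R A] [Module.Projective (MvPolynomial σ R) A]

/-- Both `L^p(A)` and its metabelian quotient `L^p(A) / B^p(A)` are projective up to `p`. -/
theorem projectiveUpTo_B {p : ℕ} (hp : 2 ≤ p) :
    ProjectiveUpTo ((p : ℤ) ^ 2) (B R A σ p) ⊥ := by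
  obtain ⟨r, hr, hf, h⟩ := exists_contract_lift (Module.Free.chooseBasis R A)
  have h1 := projectiveUpTo_liePower (R := R) (A := A) (σ := σ) (p - 1)
  rw [Nat.sub_add_cancel (by omega)] at h1
  have h2 := projectiveUpTo_gammaModule (σ := σ) (p := p) (c := 0) (n := p) _ r hr hf
    fun x hx => dynkinRelation_zero hr foxBase (foxMul_comm _) (h p x hx)
  rw [zero_add, gammaModule_zero hp, gammaModule_one] at h2
  have h3 := h1.of_quotient (inf_le_left : B R A σ p ≤ liePower R A σ p) h2
  rwa [Nat.cast_zero, zero_add, one_mul, pow_one, ← pow_two] at h3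

/-- The factor `γ_c(L') / γ_{c+1}(L')` vanishes in degree `p` unless `2c ≤ p`, and for `c ≥ 2` it is
projective up to `c (p - 1)! ^ c`, which is then prime to `p`. -/
theorem projectiveUpTo_B_coprime {p : ℕ} (hp : p.Prime) : ∃ N : ℤ, IsCoprime N (p : ℤ) ∧
    ProjectiveUpTo N (B R A σ p) ⊥ := by
  obtain ⟨r, hr, hf, h⟩ := exists_contract_lift (Module.Free.chooseBasis R A)
  let r' := degreeScaling R A p ∘ₗ r
  have hr' (z) : r' z ∈ gamma R A 0 := degreeScaling_mem_gamma p (hr z)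
  have hf' (f : A →ₗ[R] A) (z) : derivation f (r' z) -
      r' (foxDer (Module.Free.chooseBasis R A) f z) ∈ gamma R A 1 := by
    have h1 := degreeScaling_mem_gamma p (hf f z)
    rwa [map_sub, ← derivation_degreeScaling] at h1
  have h' (k : ℕ) (hk : k < p) (x) (hx : x ∈ gammaPart R A 0 k) :
      r' (ιInv (foxMap foxBase (foxMul (Module.Free.chooseBasis R A)) x)) -
        ((p - 1).factorial : ℤ) • x ∈ gamma R A 1 :=
    degreeScaling_sub_mem_gamma (y := r _) hk hx (h k x hx)
  have hstep (c : ℕ) := projectiveUpTo_gammaModule (σ := σ) (p := p) (c := c + 1)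
    (n := (p - 1).factorial) (Module.Free.chooseBasis R A) r' hr' hf'
    (fun x hx => dynkinRelation_succ hr' foxBase (foxMul_comm _) h' hx)
  -- Descending induction along the series, from the index `c + m ≥ p` where it has vanished.
  have key (m : ℕ) : ∀ c, p ≤ c + m → ∃ N : ℤ, IsCoprime N (p : ℤ) ∧
      ProjectiveUpTo N (gammaModule R A σ (c + 1) p) ⊥ := by
    induction m with
    | zero =>
      intro c hc
      refine ⟨1, isCoprime_one_left, 0, fun _ _ => rfl, fun x => ?_⟩
      have h0 := mem_gammaModule.mp x.2
      rw [gammaPart_eq_bot (by omega), Submodule.mem_bot] at h0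
      simp [h0]
    | succ m ih =>
      intro c hc
      by_cases hcp : p < 2 * (c + 2)
      · refine ⟨1, isCoprime_one_left, 0, fun _ _ => rfl, fun x => ?_⟩
        have h0 := mem_gammaModule.mp x.2
        rw [gammaPart_eq_bot (by omega), Submodule.mem_bot] at h0
        simp [h0]
      · obtain ⟨N, hN, h'⟩ := ih (c + 1) (by omega)
        refine ⟨_, ?_, (hstep c).of_extension (fun x hx => gammaPart_succ_le _ _ hx) h'⟩
        have h1 : IsCoprime ((c + 2 : ℕ) : ℤ) p := Nat.isCoprime_iff_coprime.mpr
          (Nat.coprime_of_lt_prime (by omega) (by omega) hp).symm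
        have h2 : IsCoprime (((p - 1).factorial : ℕ) : ℤ) p := Nat.isCoprime_iff_coprime.mpr
          ((Nat.Prime.coprime_iff_not_dvd hp).mpr fun hdvd => by
            have := hp.two_le
            have := hp.dvd_factorial.mp hdvd
            omega).symm
        refine hN.mul_left (IsCoprime.mul_left ?_ h2.pow_left)
        convert h1 using 1
        push_cast
        ring
  obtain ⟨N, hN, h'⟩ := key p 0 (by omega)
  rw [zero_add, gammaModule_one] at h'
  exact ⟨N, hN, h'⟩

theorem projective_B {p : ℕ} (hp : p.Prime) :
    Module.Projective (MvPolynomial σ R) (B R A σ p) := by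
  have h := projectiveUpTo_B (R := R) (A := A) (σ := σ) hp.two_le
  obtain ⟨N, hN, h'⟩ := projectiveUpTo_B_coprime (R := R) (A := A) (σ := σ) hp
  exact h'.projective hN.pow_right h

end Multiplier

end FreeLie

/-- The tensor product of a projective module with the trivial module `ℤ` is a direct summand of
a free abelian group. -/
theorem TrivialModule.free_tensorProduct {σ : Type w} {M : Type v} [AddCommGroup M]
    [Module (MvPolynomial σ ℤ) M] [Module.Projective (MvPolynomial σ ℤ) M] :
    Module.Free ℤ (TensorProduct (MvPolynomial σ ℤ) M (TrivialModule ℤ σ)) := by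
  classical
  obtain ⟨s, hs⟩ := (Module.projective_def' (R := MvPolynomial σ ℤ) (P := M)).mp
    inferInstance
  have hinj : Function.Injective (s.rTensor (TrivialModule ℤ σ)) := by
    refine Function.LeftInverse.injective
      (g := (Finsupp.linearCombination _ id).rTensor (TrivialModule ℤ σ)) fun x => ?_
    rw [← LinearMap.comp_apply, ← LinearMap.rTensor_comp, hs, LinearMap.rTensor_id,
      LinearMap.id_apply]
  let e := TensorProduct.finsuppScalarLeft (MvPolynomial σ ℤ) (TrivialModule ℤ σ) M
  have : Module.Free ℤ (TrivialModule ℤ σ) := by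
    have : Module.Free ℤ ℤ := inferInstance
    exact this
  let φ : TensorProduct (MvPolynomial σ ℤ) M (TrivialModule ℤ σ) →+ (M →₀ TrivialModule ℤ σ) :=
    (e.toLinearMap ∘ₗ s.rTensor (TrivialModule ℤ σ)).toAddMonoidHom
  exact Module.Free.of_injective_to_free φ.toIntLinearMap (e.injective.comp hinj)

end

theorem lemma3p2 {σ : Type*} [Finite σ] {A : Type*} [AddCommGroup A]
    [Module (MvPolynomial σ ℤ) A] [Module.Free (MvPolynomial σ ℤ) A]
    (p : ℕ) (hp : p.Prime) :
    Module.Free ℤ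
      (TensorProduct (MvPolynomial σ ℤ) (FreeLie.B ℤ A σ p) (TrivialModule ℤ σ)) := by
  have : Module.Free ℤ A := Module.Free.trans (S := MvPolynomial σ ℤ)
  have := FreeLie.projective_B (R := ℤ) (A := A) (σ := σ) hp
  exact TrivialModule.free_tensorProduct
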